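/- Let $n\ge 1$. For a set $K\subset\mathbb{R}^n$ write $K^*=\{\xi\in\mathbb{R}^n : x\cdot\xi\le 1 \text{ for all } x\in K\}$ and $\mathcal{P}(K)=\mathrm{vol}_n(K)\,\mathrm{vol}_n(K^*)$. Let $B_\infty^n=\{x\in\mathbb{R}^n : |x_i|\le 1,\ 1\le i\le n\}$ and $B_1^n=\{x\in\mathbb{R}^n : \sum_i|x_i|\le 1\}$, and for convex bodies $K,L\subset\mathbb{R}^n$ let $$d_{BM}(K,L)=\inf\{b/a : a,b>0 \text{ and } aK\subseteq TL\subseteq bK \text{ for some } T\in GL(n)\}.$$ Then $\mathcal{P}(B_\infty^n)=\mathrm{vol}_n(B_\infty^n)\,\mathrm{vol}_n(B_1^n)$, and there is a number $\delta=\delta(n)>0$, depending only on $n$, such that every origin-symmetric convex body $K\subset\mathbb{R}^n$ (compact, convex, with non-empty interior, $K=-K$) with $d_{BM}(K,B_\infty^n)\le 1+\delta$ satisfies $$\mathcal{P}(K)\ge\mathcal{P}(B_\infty^n).$$ Moreover, equality holds only if $d_{BM}(K,B_\infty^n)=1$ and $K$ is a parallelepiped, i.e. $K=TB_\infty^n$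 for some $T\in GL(n)$. -/

import Mathlib

open MeasureTheory
open scoped Pointwise

noncomputable section

namespace Mahler

/-- The polar body `{ξ : x ⬝ ξ ≤ 1 for all x ∈ K}` of a set in Euclidean space. -/
def polar {n : ℕ} (K : Set (EuclideanSpace ℝ (Fin n))) : Set (EuclideanSpace ℝ (Fin n)) :=
  {ξ | ∀ x ∈ K, inner ℝ x ξ ≤ 1}

/-- The volume product `vol K * vol (polar K)`, with values in `[0, ∞]`. -/
def volumeProduct {n : ℕ} (K : Set (EuclideanSpace ℝ (Fin n))) : ENNReal :=
  volume K * volume (polar K)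

/-- The cube `{x : |x i| ≤ 1 for all i}`. -/
def cube (n : ℕ) : Set (EuclideanSpace ℝ (Fin n)) :=
  {x | ∀ i, |x i| ≤ 1}

/-- The cross-polytope `{x : ∑ i, |x i| ≤ 1}`. -/
def crossPolytope (n : ℕ) : Set (EuclideanSpace ℝ (Fin n)) :=
  {x | ∑ i, |x i| ≤ 1}

/-- The multiplicative Banach-Mazur distance: the infimum of `b / a` over all `a, b > 0` for which
`a K ⊆ T L ⊆ b K` for some invertible linear map `T`. -/
def banachMazurDist {n : ℕ} (K L : Set (EuclideanSpace ℝ (Fin n))) : ℝ :=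
  sInf {r | ∃ a b : ℝ, 0 < a ∧ 0 < b ∧
    (∃ T : EuclideanSpace ℝ (Fin n) ≃ₗ[ℝ] EuclideanSpace ℝ (Fin n),
      a • K ⊆ T '' L ∧ T '' L ⊆ b • K) ∧ r = b / a}

/-- A nondegenerate parallelepiped centred at the origin: an invertible linear image of the
cube. -/
def IsCenteredParallelepiped {n : ℕ} (K : Set (EuclideanSpace ℝ (Fin n))) : Prop :=
  ∃ T : EuclideanSpace ℝ (Fin n) ≃ₗ[ℝ] EuclideanSpace ℝ (Fin n), K = T '' cube n

end Mahler

end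

noncomputable section

namespace MahlerCube

variable {n : ℕ}

/-! The cube is cut into `2 ^ n * n!` simplices, one for each complete flag of faces: the vertices
are the origin and the face centres c_F. Dividing each c_F by the codimension k of F triangulates
the cross-polytope by the same flags. Let K be near the cube, lie inside it and touch each facet at
its centre. For each face choose x_F in K and ξ_F in the polar with x_F · ξ_F = 1, x_F near c_F and
k ξ_F near c_F (`exists_isFacePair`): ξ_F maximizes a product of coordinates over the polar, and x_F
is read off from the optimality condition. Replacing centres by these points deforms the
triangulations into families of simplices inside K and inside its polar. The simplices stay disjoint
because the piecewise linear map is Lipschitz-close to the identity, so volumes are bounded below by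
sums of determinants near 1.

Let 1 + δ be the largest ℓ¹ norm on the polar; all displacements are O(δ). Summed over flags, the
first-order change of the determinants sees only the numbers c_F · (x_F - c_F) / k
(`sum_flagTrace`). Since x_F · ξ_F = 1, the contributions of K and of its polar cancel up to O(δ²)
(`neg_le_sum_flagTrace_add`). On the other hand, K or its polar contains a point beyond its deformed
triangulation by an amount of order δ (`exists_gain`), and the pyramid over that point adds volume
of order δ (`sum_det_add_mul_volume_le`). So the inequality is strict for small δ > 0, while δ = 0
forces K to be the cube.

A body at small Banach-Mazur distance from the cube is brought to this position by a linear map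
whose rows maximize a determinant over the polar (`exists_linearEquiv_isNearCube`). The volume
product is linearly invariant, so either it is strictly larger than for the cube or the body is a
parallelepiped. -/

/-- Proper faces of the cube `[-1, 1]ⁿ`, encoded by sign vectors; the zero vector is the body. -/
abbrev Face (n : ℕ) := Fin n → SignType

/-- Signed permutations; they index the complete flags of faces of the cube. -/
abbrev SignedPerm (n : ℕ) := Equiv.Perm (Fin n) × (Fin n → ℤˣ)

/-- The centre of a face of the cube. -/
def faceCenter (F : Face n) : Fin n → ℝ := fun i => ((F i : SignType) : ℝ)

/-- The sign of a unit of `ℤ`. -/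
def unitSign (u : ℤˣ) : SignType := SignType.sign (u : ℤ)

lemma unitSign_cast (u : ℤˣ) : ((unitSign u : SignType) : ℝ) = ((u : ℤ) : ℝ) := by
  rcases Int.units_eq_one_or u with rfl | rfl <;> simp [unitSign]

lemma unitSign_ne_zero (u : ℤˣ) : unitSign u ≠ 0 := by
  rcases Int.units_eq_one_or u with rfl | rfl <;> simp [unitSign]

lemma unit_mul_self (u : ℤˣ) : ((u : ℤ) : ℝ) * ((u : ℤ) : ℝ) = 1 := by
  rcases Int.units_eq_one_or u with rfl | rfl <;> simp

lemma abs_unit (u : ℤˣ) : |((u : ℤ) : ℝ)| = 1 := by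
  rcases Int.units_eq_one_or u with rfl | rfl <;> simp

lemma exists_unit_mul_eq_abs (x : ℝ) : ∃ u : ℤˣ, ((u : ℤ) : ℝ) * x = |x| := by
  rcases le_total 0 x with h | h
  · exact ⟨1, by simp [abs_of_nonneg h]⟩
  · exact ⟨-1, by simp [abs_of_nonpos h]⟩

/-! ### Flags of faces, sorted coordinates and flag cones -/

/-- The `m`-th coordinate after applying the inverse of a signed permutation, zero for `n ≤ m`. -/
def sortedCoord (g : SignedPerm n) (m : ℕ) : (Fin n → ℝ) →ₗ[ℝ] ℝ :=
  if h : m < n then ((g.2 (g.1 ⟨m, h⟩) : ℤ) : ℝ) • LinearMap.proj (g.1 ⟨m, h⟩) else 0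

lemma sortedCoord_fin (g : SignedPerm n) (j : Fin n) (y : Fin n → ℝ) :
    sortedCoord g j y = ((g.2 (g.1 j) : ℤ) : ℝ) * y (g.1 j) := by
  simp [sortedCoord]

lemma sortedCoord_of_le (g : SignedPerm n) {m : ℕ} (h : n ≤ m) : sortedCoord g m = 0 := by
  simp [sortedCoord, not_lt.mpr h]

/-- The difference of two consecutive sorted coordinates. -/
def gap (g : SignedPerm n) (k : Fin n) : (Fin n → ℝ) →ₗ[ℝ] ℝ :=
  sortedCoord g k - sortedCoord g (k + 1)

/-- The `k`-th face of the flag of a signed permutation. -/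
def flagFace (g : SignedPerm n) (k : Fin n) : Face n :=
  -- Indices start at 0: `k + 1` coordinates are fixed, so `k = 0` is a facet and the last index is
  -- a vertex.
  fun i => if g.1.symm i ≤ k then unitSign (g.2 i) else 0

/-- A telescoping sum, closed by the convention that sorted coordinates vanish from index `n` on. -/
lemma sum_gap_ge (g : SignedPerm n) (j : Fin n) (y : Fin n → ℝ) :
    ∑ k : Fin n, (if j ≤ k then gap g k y else 0) = sortedCoord g j y := by
  have h1 : ∑ k : Fin n, (if j ≤ k then gap g k y else 0)
      = ∑ m ∈ Finset.range n, if (j : ℕ) ≤ m then sortedCoord g m y - sortedCoord g (m + 1) y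
        else 0 := by
    rw [Finset.sum_range]
    rfl
  rw [h1, ← Finset.sum_filter]
  have h2 : (Finset.range n).filter (fun m => (j : ℕ) ≤ m) = Finset.Ico (j : ℕ) n := by
    ext m; simp; tauto
  rw [h2, Finset.sum_Ico_eq_sum_range, Finset.sum_congr rfl (g := fun i =>
    (fun i => sortedCoord g (j + i) y) i - (fun i => sortedCoord g (j + i) y) (i + 1))
    (fun i _ => by simp [add_assoc]), Finset.sum_range_sub']
  have : (j : ℕ) + (n - j) = n := by have := j.2; omega
  simp [this, sortedCoord_of_le]

lemma faceCenter_flagFace (g : SignedPerm n) (k j : Fin n) :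
    faceCenter (flagFace g k) (g.1 j) = if j ≤ k then ((g.2 (g.1 j) : ℤ) : ℝ) else 0 := by
  simp only [faceCenter, flagFace, Equiv.symm_apply_apply]
  split_ifs <;> simp [unitSign_cast]

/-- Abel summation: the gaps are the coordinates dual to the face centres of the flag, so each flag
cone is simplicial. -/
lemma sum_gap_smul_faceCenter (g : SignedPerm n) (y : Fin n → ℝ) :
    ∑ k, gap g k y • faceCenter (flagFace g k) = y := by
  ext i
  obtain ⟨j, rfl⟩ := g.1.surjective i
  simp only [Finset.sum_apply, Pi.smul_apply, smul_eq_mul, faceCenter_flagFace, mul_ite, mul_zero]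
  have : ∀ k : Fin n, (if j ≤ k then gap g k y * ((g.2 (g.1 j) : ℤ) : ℝ) else 0)
    = (if j ≤ k then gap g k y else 0) * ((g.2 (g.1 j) : ℤ) : ℝ) := fun k => by split_ifs <;> simp
  simp only [this]
  rw [← Finset.sum_mul, sum_gap_ge, sortedCoord_fin]
  linear_combination y (g.1 j) * unit_mul_self (g.2 (g.1 j))

/-- The closed cone spanned by the flag of a signed permutation. -/
def flagCone (g : SignedPerm n) : Set (Fin n → ℝ) := {y | ∀ k, 0 ≤ gap g k y}

/-- The interior of `flagCone g`. -/
def openFlagCone (g : SignedPerm n) : Set (Fin n → ℝ) := {y | ∀ k, 0 < gap g k y}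

lemma openFlagCone_subset (g : SignedPerm n) : openFlagCone g ⊆ flagCone g :=
  fun _ hy k => (hy k).le

lemma sortedCoord_succ_le {g : SignedPerm n} {y : Fin n → ℝ} (hy : y ∈ flagCone g) (m : ℕ) :
    sortedCoord g (m + 1) y ≤ sortedCoord g m y := by
  by_cases h : m < n
  · have := hy ⟨m, h⟩
    simp only [gap, LinearMap.sub_apply] at this
    linarith
  · rw [sortedCoord_of_le g (by omega), sortedCoord_of_le g (by omega)]

lemma sortedCoord_antitone {g : SignedPerm n} {y : Fin n → ℝ} (hy : y ∈ flagCone g) :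
    Antitone fun m => sortedCoord g m y :=
  antitone_nat_of_succ_le (sortedCoord_succ_le hy)

lemma sortedCoord_nonneg {g : SignedPerm n} {y : Fin n → ℝ} (hy : y ∈ flagCone g) (m : ℕ) :
    0 ≤ sortedCoord g m y := by
  have := sortedCoord_antitone hy (le_max_left m n)
  simpa [sortedCoord_of_le g (le_max_right m n)] using this

lemma sortedCoord_eq_abs {g : SignedPerm n} {y : Fin n → ℝ} (hy : y ∈ flagCone g) (j : Fin n) :
    sortedCoord g j y = |y (g.1 j)| := by
  have := sortedCoord_nonneg hy j
  rw [← abs_of_nonneg this, sortedCoord_fin, abs_mul, abs_unit, one_mul]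

lemma exists_mem_flagCone (y : Fin n → ℝ) : ∃ g : SignedPerm n, y ∈ flagCone g := by
  choose e he using fun i => exists_unit_mul_eq_abs (y i)
  -- Sorting is increasing, so the negated absolute values give decreasing absolute values.
  let σ := Tuple.sort fun i => -|y i|
  have hσ : Monotone ((fun i => -|y i|) ∘ σ) := Tuple.monotone_sort _
  refine ⟨(σ, e), fun k => ?_⟩
  simp only [gap, LinearMap.sub_apply, sortedCoord_fin, he]
  by_cases h : (k : ℕ) + 1 < n
  · have h1 := sortedCoord_fin (σ, e) ⟨k + 1, h⟩ y
    simp only [he] at h1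
    have h2 := hσ (show k ≤ ⟨k + 1, h⟩ from Nat.le_succ k)
    simp only [Function.comp] at h2
    rw [h1]; linarith
  · rw [sortedCoord_of_le _ (by omega)]
    simp

lemma flagFace_injective (g : SignedPerm n) : Function.Injective (flagFace g) := by
  have key : ∀ k l : Fin n, flagFace g k = flagFace g l → k ≤ l := by
    intro k l h
    by_contra hlt
    have := congrFun h (g.1 k)
    simp [flagFace, hlt, unitSign_ne_zero] at this
  exact fun k l h => le_antisymm (key k l h) (key l k h.symm)

/-! ### Face coefficients and the piecewise linear map -/

/-- The coefficient of the centre of a face in the piecewise linear expansion of a vector. -/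
def faceCoeff (F : Face n) (y : Fin n → ℝ) : ℝ :=
  -- The least signed coordinate over fixed directions minus the largest absolute coordinate over
  -- free ones. The defaults `‖y‖` and `0` are neutral for these extrema. No cone is chosen, so
  -- continuity across cones comes for free.
  max 0 ((⨅ i, if F i = 0 then ‖y‖ else ((F i : SignType) : ℝ) * y i)
    - ⨆ i, if F i = 0 then |y i| else 0)

lemma abs_ciInf_sub_le [NeZero n] {f g : Fin n → ℝ} {c : ℝ} (h : ∀ i, |f i - g i| ≤ c) :
    |(⨅ i, f i) - ⨅ i, g i| ≤ c := by
  have key : ∀ f g : Fin n → ℝ, (∀ i, |f i - g i| ≤ c) → (⨅ i, f i) - c ≤ ⨅ i, g i := by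
    intro f g h
    refine le_ciInf fun i => ?_
    have h1 := ciInf_le (Set.finite_range f).bddBelow i
    have := (abs_le.1 (h i)).2
    linarith
  have h1 := key f g h
  have h2 := key g f fun i => by rw [abs_sub_comm]; exact h i
  rw [abs_le]; constructor <;> linarith

lemma abs_ciSup_sub_le [NeZero n] {f g : Fin n → ℝ} {c : ℝ} (h : ∀ i, |f i - g i| ≤ c) :
    |(⨆ i, f i) - ⨆ i, g i| ≤ c := by
  have key : ∀ f g : Fin n → ℝ, (∀ i, |f i - g i| ≤ c) → (⨆ i, f i) ≤ (⨆ i, g i) + c := by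
    intro f g h
    refine ciSup_le fun i => ?_
    have h1 := le_ciSup (Set.finite_range g).bddAbove i
    have := (abs_le.1 (h i)).2
    linarith
  have h1 := key f g h
  have h2 := key g f fun i => by rw [abs_sub_comm]; exact h i
  rw [abs_le]; constructor <;> linarith

lemma abs_sub_le_norm (y z : Fin n → ℝ) (i : Fin n) : |y i - z i| ≤ ‖y - z‖ := by
  simpa using norm_le_pi_norm (y - z) i

/-- The infimum and the supremum are each 1-Lipschitz in the sup norm, and truncation at 0 does not
increase distances. -/
lemma abs_faceCoeff_sub_le [NeZero n] (F : Face n) (y z : Fin n → ℝ) :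
    |faceCoeff F y - faceCoeff F z| ≤ 2 * ‖y - z‖ := by
  unfold faceCoeff
  have h1 := abs_ciInf_sub_le
    (f := fun i => if F i = 0 then ‖y‖ else ((F i : SignType) : ℝ) * y i)
    (g := fun i => if F i = 0 then ‖z‖ else ((F i : SignType) : ℝ) * z i) (c := ‖y - z‖) (by
      intro i
      have := abs_sub_le_norm y z i
      cases h : F i
      · simp [abs_norm_sub_norm_le]
      · simp only [reduceCtorEq, SignType.neg_eq_neg_one, SignType.coe_neg_one, neg_mul, one_mul]
        rw [if_neg (by decide), if_neg (by decide), neg_sub_neg, abs_sub_comm]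
        exact this
      · simpa using this)
  have h2 := abs_ciSup_sub_le
    (f := fun i => if F i = 0 then |y i| else 0)
    (g := fun i => if F i = 0 then |z i| else 0) (c := ‖y - z‖) (by
      intro i
      have := abs_sub_le_norm y z i
      split_ifs
      · exact (abs_abs_sub_abs_le_abs_sub _ _).trans this
      · simp)
  refine (abs_max_sub_max_le_max _ _ _ _).trans (max_le (by simp) ?_)
  rw [abs_le] at *
  constructor <;> linarith [h1.1, h1.2, h2.1, h2.2]

lemma faceCoeff_flagFace [NeZero n] {g : SignedPerm n} {y : Fin n → ℝ} (hy : y ∈ flagCone g)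
    (k : Fin n) : faceCoeff (flagFace g k) y = gap g k y := by
  have hmono := sortedCoord_antitone hy
  have e1 : (⨅ i, if flagFace g k i = 0 then ‖y‖ else ((flagFace g k i : SignType) : ℝ) * y i)
      = sortedCoord g k y := by
    apply le_antisymm
    · refine (ciInf_le (Set.finite_range _).bddBelow (g.1 k)).trans ?_
      simp [flagFace, unitSign_ne_zero, unitSign_cast, sortedCoord_fin]
    · refine le_ciInf fun i => ?_
      obtain ⟨j, rfl⟩ := g.1.surjective i
      by_cases hj : j ≤ k
      · simp only [flagFace, Equiv.symm_apply_apply, hj, if_true, unitSign_ne_zero, if_false,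
          unitSign_cast]
        rw [← sortedCoord_fin]
        exact hmono (by exact_mod_cast hj)
      · simp only [flagFace, Equiv.symm_apply_apply, hj, if_false, if_true]
        rw [sortedCoord_eq_abs hy]
        exact norm_le_pi_norm y _
  have e2 : (⨆ i, if flagFace g k i = 0 then |y i| else 0) = sortedCoord g (k + 1) y := by
    apply le_antisymm
    · refine ciSup_le fun i => ?_
      obtain ⟨j, rfl⟩ := g.1.surjective i
      by_cases hj : j ≤ k
      · simp only [flagFace, Equiv.symm_apply_apply, hj, if_true, unitSign_ne_zero, if_false]
        exact sortedCoord_nonneg hy _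
      · simp only [flagFace, Equiv.symm_apply_apply, hj, if_false, if_true]
        rw [← sortedCoord_eq_abs hy]
        exact hmono (by have : k < j := not_le.1 hj; exact_mod_cast this)
    · by_cases h : (k : ℕ) + 1 < n
      · refine le_trans ?_ (le_ciSup (Set.finite_range _).bddAbove (g.1 ⟨k + 1, h⟩))
        have h1 := sortedCoord_eq_abs hy ⟨k + 1, h⟩
        have h2 : ¬ (⟨k + 1, h⟩ : Fin n) ≤ k := by simp [Fin.le_def]
        simp only [flagFace, Equiv.symm_apply_apply, h2, if_false, if_true, ← h1]
        exact le_rfl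
      · rw [sortedCoord_of_le _ (by omega)]
        refine Real.iSup_nonneg fun i => ?_
        split_ifs <;> simp
  unfold faceCoeff
  rw [e1, e2]
  exact max_eq_right (hy k)

/-- Off the flag the untruncated coefficient is nonpositive for one of three reasons: a signed
coordinate is nonpositive, the sign vector is zero, or a free coordinate precedes a fixed one in the
sorted order. -/
lemma faceCoeff_eq_zero [NeZero n] {g : SignedPerm n} {y : Fin n → ℝ} (hy : y ∈ flagCone g)
    {F : Face n} (hF : F ∉ Set.range (flagFace g)) : faceCoeff F y = 0 := by
  have hmono := sortedCoord_antitone hy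
  have hsup := fun i => le_ciSup (Set.finite_range fun i => if F i = 0 then |y i| else 0).bddAbove i
  have hinf := fun i => ciInf_le
    (Set.finite_range fun i => if F i = 0 then ‖y‖ else ((F i : SignType) : ℝ) * y i).bddBelow i
  have hsup0 : 0 ≤ ⨆ i, if F i = 0 then |y i| else 0 :=
    Real.iSup_nonneg fun i => by split_ifs <;> simp
  refine max_eq_left (sub_nonpos.2 ?_)
  by_cases h0 : ∃ i, F i ≠ 0 ∧ ((F i : SignType) : ℝ) * y i ≤ 0
  · obtain ⟨i, hi, hi'⟩ := h0
    refine (hinf i).trans ?_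
    simp only [hi, if_false]
    exact hi'.trans hsup0
  push Not at h0
  by_cases hz : ∀ i, F i = 0
  · refine (hinf 0).trans ?_
    simp only [hz, if_true] at hsup ⊢
    refine (pi_norm_le_iff_of_nonneg ?_).2 fun i => hsup i
    exact (abs_nonneg _).trans (hsup 0)
  push Not at hz
  let S : Finset (Fin n) := Finset.univ.filter fun j => F (g.1 j) ≠ 0
  have hS : S.Nonempty := by
    obtain ⟨i, hi⟩ := hz
    exact ⟨g.1.symm i, by simpa [S] using hi⟩
  have hmax : F (g.1 (S.max' hS)) ≠ 0 := by simpa [S] using S.max'_mem hS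
  by_cases hall : ∀ j ≤ S.max' hS, F (g.1 j) ≠ 0
  · refine absurd ⟨S.max' hS, ?_⟩ hF
    ext1 i
    obtain ⟨j, rfl⟩ := g.1.surjective i
    simp only [flagFace, Equiv.symm_apply_apply]
    split_ifs with hj
    · have h1 := h0 _ (hall j hj)
      have h2 := sortedCoord_nonneg hy j
      rw [sortedCoord_fin] at h2
      have h3 := hall j hj
      rcases Int.units_eq_one_or (g.2 (g.1 j)) with hu | hu
      · rw [hu] at h2 ⊢
        cases h : F (g.1 j)
        · exact absurd h h3
        · rw [h] at h1; simp at h1 h2; linarith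
        · rfl
      · rw [hu] at h2 ⊢
        cases h : F (g.1 j)
        · exact absurd h h3
        · rfl
        · rw [h] at h1; simp at h1 h2; linarith
    · by_contra hne
      exact hj (S.le_max' j (by simpa [S] using Ne.symm hne))
  · push Not at hall
    obtain ⟨j, hj, hFj⟩ := hall
    refine (hinf (g.1 (S.max' hS))).trans (le_trans ?_ (hsup (g.1 j)))
    simp only [hmax, if_false, hFj, if_true]
    rw [← sortedCoord_eq_abs hy]
    refine le_trans ?_ (hmono (show (j : ℕ) ≤ (S.max' hS : Fin n) from by exact_mod_cast hj))
    dsimp only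
    rw [sortedCoord_eq_abs hy]
    cases F (g.1 (S.max' hS)) <;> simp [le_abs_self, neg_le_abs]

lemma sum_faceCoeff [NeZero n] {E : Type*} [AddCommGroup E] [Module ℝ E] {g : SignedPerm n}
    {y : Fin n → ℝ} (hy : y ∈ flagCone g) (X : Face n → E) :
    ∑ F, faceCoeff F y • X F = ∑ k, gap g k y • X (flagFace g k) := by
  symm
  refine Fintype.sum_of_injective (flagFace g) (flagFace_injective g) _ _ ?_ ?_
  · intro F hF
    simp [faceCoeff_eq_zero hy hF]
  · intro k
    rw [faceCoeff_flagFace hy]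

/-- The piecewise linear map sending the centre of each face `F` to `X F`. -/
def flagMap (X : Face n → Fin n → ℝ) (y : Fin n → ℝ) : Fin n → ℝ := ∑ F, faceCoeff F y • X F

/-- The linear map agreeing with `flagMap X` on `flagCone g`. -/
def flagLinear (X : Face n → Fin n → ℝ) (g : SignedPerm n) : (Fin n → ℝ) →ₗ[ℝ] (Fin n → ℝ) :=
  ∑ k, (gap g k).smulRight (X (flagFace g k))

lemma flagLinear_apply (X : Face n → Fin n → ℝ) (g : SignedPerm n) (y : Fin n → ℝ) :
    flagLinear X g y = ∑ k, gap g k y • X (flagFace g k) := by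
  simp [flagLinear]

lemma flagMap_eq [NeZero n] (X : Face n → Fin n → ℝ) {g : SignedPerm n} {y : Fin n → ℝ}
    (hy : y ∈ flagCone g) : flagMap X y = flagLinear X g y := by
  rw [flagLinear_apply, flagMap, sum_faceCoeff hy]

lemma flagMap_faceCenter [NeZero n] (y : Fin n → ℝ) : flagMap faceCenter y = y := by
  obtain ⟨g, hg⟩ := exists_mem_flagCone y
  rw [flagMap_eq _ hg, flagLinear_apply, sum_gap_smul_faceCenter]

lemma flagLinear_faceCenter (g : SignedPerm n) :
    flagLinear faceCenter g = LinearMap.id := by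
  refine LinearMap.ext fun y => ?_
  simp [flagLinear_apply, sum_gap_smul_faceCenter]

/-- With the centres themselves as values the map is the identity, so only the displacements
contribute: `3 ^ n` sign vectors, each with a 2-Lipschitz coefficient. This one bound yields both
injectivity and surjectivity. -/
lemma norm_flagMap_sub_le [NeZero n] {X : Face n → Fin n → ℝ} {ε : ℝ}
    (hX : ∀ F, ‖X F - faceCenter F‖ ≤ ε) (y z : Fin n → ℝ) :
    ‖flagMap X y - flagMap X z - (y - z)‖ ≤ 2 * 3 ^ n * ε * ‖y - z‖ := by
  have h : flagMap X y - flagMap X z - (y - z)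
      = ∑ F, (faceCoeff F y - faceCoeff F z) • (X F - faceCenter F) := by
    conv_lhs => rw [← flagMap_faceCenter y, ← flagMap_faceCenter z]
    simp only [flagMap_faceCenter]
    nth_rewrite 2 [← flagMap_faceCenter y]
    nth_rewrite 2 [← flagMap_faceCenter z]
    simp only [flagMap, ← Finset.sum_sub_distrib]
    refine Finset.sum_congr rfl fun F _ => ?_
    module
  rw [h]
  refine (norm_sum_le _ _).trans ((Finset.sum_le_sum (g := fun _ => 2 * ‖y - z‖ * ε) ?_).trans ?_)
  · intro F _
    rw [norm_smul, Real.norm_eq_abs]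
    exact mul_le_mul (abs_faceCoeff_sub_le F y z) (hX F) (norm_nonneg _) (by positivity)
  · have : Fintype.card SignType = 3 := rfl
    simp [this]
    apply le_of_eq; ring

/-- A point of an open cone has nonzero coordinates with distinct absolute values; their signs and
their decreasing order determine the signed permutation. -/
lemma openFlagCone_disjoint {g g' : SignedPerm n} {y : Fin n → ℝ} (h : y ∈ openFlagCone g)
    (h' : y ∈ openFlagCone g') : g = g' := by
  have anti : ∀ g : SignedPerm n, y ∈ openFlagCone g →
      (∀ i, 0 < ((g.2 i : ℤ) : ℝ) * y i) ∧ StrictAnti ((fun i => |y i|) ∘ g.1) := by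
    intro g h
    have hc := openFlagCone_subset g h
    have hlt : ∀ k l : Fin n, k < l → sortedCoord g l y < sortedCoord g k y := by
      intro k l hkl
      have h1 := h k
      have h2 := sortedCoord_antitone hc (show (k : ℕ) + 1 ≤ l from hkl)
      simp only [gap, LinearMap.sub_apply] at h1
      dsimp only at h2
      linarith
    refine ⟨fun i => ?_, fun k l hkl => ?_⟩
    · obtain ⟨j, rfl⟩ := g.1.surjective i
      rw [← sortedCoord_fin]
      have h1 := h j
      have h2 := sortedCoord_nonneg hc (j + 1)
      simp only [gap, LinearMap.sub_apply] at h1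
      linarith
    · have := hlt k l hkl
      rwa [sortedCoord_eq_abs hc, sortedCoord_eq_abs hc] at this
  obtain ⟨s, a⟩ := anti g h
  obtain ⟨s', a'⟩ := anti g' h'
  have e2 : g.2 = g'.2 := by
    ext1 i
    have h1 := s i
    have h2 := s' i
    rcases Int.units_eq_one_or (g.2 i) with hu | hu <;>
    rcases Int.units_eq_one_or (g'.2 i) with hu' | hu' <;> rw [hu] at h1 <;> rw [hu'] at h2 <;>
    simp [hu, hu'] at h1 h2 ⊢ <;> linarith
  have hh := Tuple.unique_antitone a.antitone a'.antitone
  have e1 : g.1 = g'.1 := by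
    ext1 k
    have hinj : Function.Injective fun i => |y i| := by
      intro i j hij
      have := a.injective (a₁ := g.1.symm i) (a₂ := g.1.symm j) (by simpa using hij)
      simpa using this
    exact hinj (congrFun hh k)
  exact Prod.ext e1 e2

/-! ### First-order expansion of determinants near the identity -/

lemma abs_prod_one_add_sub_le {ι : Type*} (s : Finset ι) {a : ι → ℝ} {ε : ℝ} (hε : ε ≤ 1)
    (ha : ∀ i, |a i| ≤ ε) : |∏ i ∈ s, (1 + a i) - 1 - ∑ i ∈ s, a i| ≤ 4 ^ s.card * ε ^ 2 := by
  classical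
  induction s using Finset.induction_on with
  | empty => simp; positivity
  | insert i s hi ih =>
    have hε0 : 0 ≤ ε := (abs_nonneg _).trans (ha i)
    have hS : |∑ i ∈ s, a i| ≤ s.card * ε := by
      refine (Finset.abs_sum_le_sum_abs _ _).trans ?_
      refine (Finset.sum_le_sum fun i _ => ha i).trans ?_
      simp
    have hP : |∏ i ∈ s, (1 + a i) - 1| ≤ 4 ^ s.card * ε ^ 2 + s.card * ε := by
      calc _ = |(∏ i ∈ s, (1 + a i) - 1 - ∑ i ∈ s, a i) + ∑ i ∈ s, a i| := by congr 1; ring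
        _ ≤ _ := (abs_add_le _ _).trans (add_le_add ih hS)
    have hcard : (s.card : ℝ) ≤ 4 ^ s.card := by
      exact_mod_cast (Nat.lt_pow_self (by norm_num : 1 < 4)).le
    rw [Finset.prod_insert hi, Finset.sum_insert hi, Finset.card_insert_of_notMem hi]
    calc _ = |(∏ i ∈ s, (1 + a i) - 1 - ∑ i ∈ s, a i) + a i * (∏ i ∈ s, (1 + a i) - 1)| := by
          congr 1; ring
      _ ≤ 4 ^ s.card * ε ^ 2 + ε * (4 ^ s.card * ε ^ 2 + s.card * ε) := by
          refine (abs_add_le _ _).trans (add_le_add ih ?_)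
          rw [abs_mul]
          exact mul_le_mul (ha i) hP (abs_nonneg _) hε0
      _ ≤ 4 ^ s.card * ε ^ 2 + (4 ^ s.card * ε ^ 2 + 4 ^ s.card * ε ^ 2) := by
          have h1 : ε * (4 ^ s.card * ε ^ 2) ≤ 1 * (4 ^ s.card * ε ^ 2) := by gcongr
          have h2 : (s.card : ℝ) * ε ^ 2 ≤ 4 ^ s.card * ε ^ 2 := by gcongr
          nlinarith
      _ ≤ 4 ^ (s.card + 1) * ε ^ 2 := by
          have : 0 ≤ (4 : ℝ) ^ s.card * ε ^ 2 := by positivity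
          rw [pow_succ 4]; linarith

/-- In the Leibniz formula the identity permutation supplies `1 + E.trace` up to order ε². Every
other permutation moves at least two indices, hence has two off-diagonal factors of size ε. -/
lemma abs_det_one_add_sub_le {E : Matrix (Fin n) (Fin n) ℝ} {ε : ℝ} (hε0 : 0 ≤ ε) (hε : ε ≤ 1)
    (hE : ∀ i j, |E i j| ≤ ε) :
    |(1 + E).det - 1 - E.trace| ≤ n.factorial * 4 ^ n * ε ^ 2 := by
  have hterm : ∀ σ : Equiv.Perm (Fin n), |(Equiv.Perm.sign σ : ℤ) * ∏ i, (1 + E) (σ i) i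
      - (if σ = 1 then 1 + E.trace else 0)| ≤ 4 ^ n * ε ^ 2 := by
    intro σ
    by_cases hσ : σ = 1
    · subst hσ
      have := abs_prod_one_add_sub_le Finset.univ (a := fun i => E i i) hε (fun i => hE i i)
      simpa [Matrix.trace, sub_sub] using this
    · rw [if_neg hσ, sub_zero, abs_mul, Finset.abs_prod]
      obtain ⟨i, hi⟩ : ∃ i, σ i ≠ i := by
        by_contra! h
        exact hσ (Equiv.ext h)
      have hb : ∀ j, |(1 + E) (σ j) j| ≤ 2 * (if j = i ∨ j = σ i then ε else 1) := by
        intro j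
        split_ifs with hj
        · have : σ j ≠ j := by
            rcases hj with rfl | rfl
            · exact hi
            · exact fun h => hi (σ.injective h)
          simp only [Matrix.add_apply, Matrix.one_apply_ne this, zero_add]
          linarith [hE (σ j) j]
        · simp only [Matrix.add_apply]
          have h1 : |(1 : Matrix (Fin n) (Fin n) ℝ) (σ j) j| ≤ 1 := by
            rw [Matrix.one_apply]; split_ifs <;> simp
          linarith [abs_add_le ((1 : Matrix (Fin n) (Fin n) ℝ) (σ j) j) (E (σ j) j), hE (σ j) j]
      have hs : |(((Equiv.Perm.sign σ : ℤˣ) : ℤ) : ℝ)| = 1 := abs_unit _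
      rw [hs, one_mul]
      refine (Finset.prod_le_prod (fun j _ => abs_nonneg _) fun j _ => hb j).trans ?_
      rw [Finset.prod_mul_distrib, Finset.prod_ite, Finset.prod_const_one, mul_one,
        Finset.prod_const, Finset.prod_const]
      have : (Finset.univ.filter fun j => j = i ∨ j = σ i) = {i, σ i} := by ext; simp
      rw [this, Finset.card_pair hi.symm, Finset.card_univ, Fintype.card_fin]
      gcongr
      norm_num
  have hsum : (1 + E).det - 1 - E.trace = ∑ σ : Equiv.Perm (Fin n),
      ((Equiv.Perm.sign σ : ℤ) * ∏ i, (1 + E) (σ i) i - (if σ = 1 then 1 + E.trace else 0)) := by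
    rw [Finset.sum_sub_distrib, ← Matrix.det_apply']
    simp; ring
  rw [hsum]
  refine (Finset.abs_sum_le_sum_abs _ _).trans ((Finset.sum_le_sum fun σ _ => hterm σ).trans ?_)
  simp [Fintype.card_perm, mul_assoc]

/-! ### The first-order term and its sum over all flags -/

/-- The trace of the perturbation `flagLinear X g - id` on the cone of a flag. -/
def flagTrace (X : Face n → Fin n → ℝ) (g : SignedPerm n) : ℝ :=
  ∑ k, gap g k (X (flagFace g k) - faceCenter (flagFace g k))

lemma abs_sortedCoord_le (g : SignedPerm n) (m : ℕ) (y : Fin n → ℝ) : |sortedCoord g m y| ≤ ‖y‖ := by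
  by_cases h : m < n
  · have := sortedCoord_fin g ⟨m, h⟩ y
    dsimp only at this
    rw [this, abs_mul, abs_unit, one_mul]
    exact norm_le_pi_norm y _
  · simp [sortedCoord_of_le g (not_lt.1 h)]

lemma abs_gap_le (g : SignedPerm n) (k : Fin n) (y : Fin n → ℝ) : |gap g k y| ≤ 2 * ‖y‖ := by
  rw [gap, LinearMap.sub_apply]
  have h := abs_sub (sortedCoord g k y) (sortedCoord g (k + 1) y)
  linarith [abs_sortedCoord_le g k y, abs_sortedCoord_le g (k + 1) y]

/-- The perturbation is a sum of `n` rank-one maps whose matrix entries are at most `2 * ε`, which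
is where `2 * n * ε` comes from. -/
lemma abs_det_flagLinear_sub_le {X : Face n → Fin n → ℝ} {ε : ℝ} (hε0 : 0 ≤ ε)
    (hε : 2 * n * ε ≤ 1) (hX : ∀ F, ‖X F - faceCenter F‖ ≤ ε) (g : SignedPerm n) :
    |(flagLinear X g).det - 1 - flagTrace X g| ≤ n.factorial * 4 ^ n * (2 * n * ε) ^ 2 := by
  let E : Matrix (Fin n) (Fin n) ℝ := fun i j =>
    ∑ k, gap g k (Pi.single j 1) * (X (flagFace g k) - faceCenter (flagFace g k)) i
  have hlin : flagLinear X g = Matrix.toLin' (1 + E) := by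
    have h0 : flagLinear X g = LinearMap.id
        + ∑ k, (gap g k).smulRight (X (flagFace g k) - faceCenter (flagFace g k)) := by
      rw [← flagLinear_faceCenter g, flagLinear, flagLinear, ← Finset.sum_add_distrib]
      refine Finset.sum_congr rfl fun k _ => LinearMap.ext fun y => ?_
      simp only [LinearMap.smulRight_apply, LinearMap.add_apply]
      module
    rw [h0, map_add, Matrix.toLin'_one]
    congr 1
    apply LinearMap.toMatrix'.injective
    rw [LinearMap.toMatrix'_toLin']
    ext i j
    simp [LinearMap.toMatrix'_apply, E]
  have htr : E.trace = flagTrace X g := by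
    simp only [Matrix.trace, Matrix.diag, E, flagTrace]
    rw [Finset.sum_comm]
    refine Finset.sum_congr rfl fun k _ => ?_
    conv_rhs => rw [pi_eq_sum_univ' (X (flagFace g k) - faceCenter (flagFace g k)), map_sum]
    refine Finset.sum_congr rfl fun i _ => ?_
    rw [map_smul, smul_eq_mul, mul_comm]
  rw [hlin, LinearMap.det_toLin', ← htr]
  refine abs_det_one_add_sub_le (by positivity) hε fun i j => ?_
  refine (Finset.abs_sum_le_sum_abs _ _).trans ((Finset.sum_le_sum (g := fun _ => 2 * ε) ?_).trans ?_)
  · intro k _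
    rw [abs_mul]
    refine mul_le_mul ((abs_gap_le _ _ _).trans ?_) ?_ (abs_nonneg _) (by norm_num)
    · rw [Pi.norm_single]; simp
    · exact (norm_le_pi_norm _ i).trans (hX _)
  · simp; apply le_of_eq; ring

/-- Flipping the sign at position `k + 1` leaves the `k`-th face unchanged and reverses the term, so
terms cancel in pairs. -/
lemma sum_sortedCoord_succ (D : Face n → Fin n → ℝ) (k : Fin n) :
    ∑ g : SignedPerm n, sortedCoord g (k + 1) (D (flagFace g k)) = 0 := by
  by_cases h : (k : ℕ) + 1 < n
  · let l : Fin n := ⟨k + 1, h⟩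
    have hl : ∀ (g : SignedPerm n) y, sortedCoord g (k + 1) y = ((g.2 (g.1 l) : ℤ) : ℝ) * y (g.1 l) :=
      fun g y => sortedCoord_fin g l y
    refine Finset.sum_involution
      (fun g _ => (g.1, Function.update g.2 (g.1 l) (-(g.2 (g.1 l))))) ?_ ?_ ?_ ?_
    · intro g _
      have hf : flagFace (g.1, Function.update g.2 (g.1 l) (-(g.2 (g.1 l)))) k = flagFace g k := by
        ext1 i
        by_cases hi : i = g.1 l
        · have : ¬ l ≤ k := by simp [l, Fin.le_def]
          subst hi
          simp [flagFace, this]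
        · simp [flagFace, Function.update_of_ne hi]
      rw [hf, hl, hl]
      simp
    · intro g _ _ heq
      have := congrFun (congrArg Prod.snd heq) (g.1 l)
      simp at this
    · simp
    · intro g _
      simp
  · simp [sortedCoord_of_le _ (not_lt.1 h)]

/-- Interchanging positions `j` and `k` permutes the flags and keeps the `k`-th face, which depends
only on the set of its first `k + 1` positions. -/
lemma sum_sortedCoord_swap (D : Face n → Fin n → ℝ) {j k : Fin n} (hjk : j ≤ k) :
    ∑ g : SignedPerm n, sortedCoord g j (D (flagFace g k))
      = ∑ g : SignedPerm n, sortedCoord g k (D (flagFace g k)) := by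
  refine Fintype.sum_equiv (Equiv.prodCongr (Equiv.mulRight (Equiv.swap j k)) (Equiv.refl _)) _ _ ?_
  intro g
  have hf : flagFace (g.1 * Equiv.swap j k, g.2) k = flagFace g k := by
    ext1 i
    obtain ⟨m, rfl⟩ := g.1.surjective i
    have hm : Equiv.swap j k m ≤ k ↔ m ≤ k := by
      rw [Equiv.swap_apply_def]
      split_ifs with h1 h2
      · simp [h1, hjk]
      · simp [h2, hjk]
      · rfl
    have : (g.1 * Equiv.swap j k).symm (g.1 m) = Equiv.swap j k m := by
      rw [Equiv.symm_apply_eq]; simp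
    simp only [flagFace, this, hm, Equiv.symm_apply_apply]
  simp only [Equiv.prodCongr_apply, Prod.map, Equiv.coe_mulRight, Equiv.refl_apply]
  rw [hf, sortedCoord_fin, sortedCoord_fin]
  simp

/-- In the sum over flags only the leading coordinate of each gap survives, and it may be replaced
by the mean over the `k + 1` fixed coordinates. The result depends on each face separately, which
lets body and polar be compared face by face. -/
lemma sum_flagTrace (X : Face n → Fin n → ℝ) :
    ∑ g, flagTrace X g = ∑ g : SignedPerm n, ∑ k : Fin n, ((k : ℝ) + 1)⁻¹ *
      (faceCenter (flagFace g k) ⬝ᵥ (X (flagFace g k) - faceCenter (flagFace g k))) := by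
  let D : Face n → Fin n → ℝ := fun F => X F - faceCenter F
  change ∑ g : SignedPerm n, ∑ k, gap g k (D (flagFace g k)) = ∑ g : SignedPerm n, ∑ k : Fin n,
    ((k : ℝ) + 1)⁻¹ * (faceCenter (flagFace g k) ⬝ᵥ D (flagFace g k))
  rw [Finset.sum_comm]
  conv_rhs => rw [Finset.sum_comm]
  refine Finset.sum_congr rfl fun k _ => ?_
  simp only [gap, LinearMap.sub_apply, Finset.sum_sub_distrib]
  rw [sum_sortedCoord_succ, sub_zero, ← Finset.mul_sum, eq_inv_mul_iff_mul_eq₀ (by positivity)]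
  have h1 : ∀ g : SignedPerm n, faceCenter (flagFace g k) ⬝ᵥ D (flagFace g k)
      = ∑ j ∈ Finset.Iic k, sortedCoord g j (D (flagFace g k)) := by
    intro g
    rw [dotProduct, ← Equiv.sum_comp g.1]
    simp only [faceCenter_flagFace, ite_mul, zero_mul, ← Finset.sum_filter, sortedCoord_fin]
    refine Finset.sum_congr ?_ fun _ _ => rfl
    ext; simp
  simp only [h1]
  rw [Finset.sum_comm, Finset.sum_congr rfl fun j hj => sum_sortedCoord_swap D (Finset.mem_Iic.1 hj)]
  simp

/-! ### Flag simplices and their volumes -/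

lemma volume_levelSet_eq_zero {f : (Fin n → ℝ) →ₗ[ℝ] ℝ} (hf : f ≠ 0) (c : ℝ) :
    volume {y | f y = c} = 0 := by
  rcases Set.eq_empty_or_nonempty {y | f y = c} with h | ⟨y₀, hy₀⟩
  · simp [h]
  · have h1 : {y | f y = c} = (fun y => y + -y₀) ⁻¹' (LinearMap.ker f : Set (Fin n → ℝ)) := by
      ext y
      have : f y₀ = c := hy₀
      simp [this, ← sub_eq_add_neg, sub_eq_zero]
    rw [h1, measure_preimage_add_right]
    exact Measure.addHaar_submodule _ _ fun h => hf (LinearMap.ker_eq_top.1 h)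

lemma sortedCoord_faceCenter (g : SignedPerm n) (m l : Fin n) :
    sortedCoord g m (faceCenter (flagFace g l)) = if m ≤ l then 1 else 0 := by
  rw [sortedCoord_fin, faceCenter_flagFace]
  split_ifs <;> simp [unit_mul_self]

lemma gap_faceCenter (g : SignedPerm n) (k l : Fin n) :
    gap g k (faceCenter (flagFace g l)) = if k = l then 1 else 0 := by
  rw [gap, LinearMap.sub_apply, sortedCoord_faceCenter]
  by_cases h : (k : ℕ) + 1 < n
  · have := sortedCoord_faceCenter g ⟨k + 1, h⟩ l
    dsimp only at this
    rw [this]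
    rcases lt_trichotomy k l with hkl | rfl | hkl
    · have h2 : (⟨(k : ℕ) + 1, h⟩ : Fin n) ≤ l := hkl
      simp [hkl.le, hkl.ne, h2]
    · simp [Fin.le_def]
    · have h2 : ¬ (⟨k + 1, h⟩ : Fin n) ≤ l := by rw [Fin.le_def]; dsimp only; omega
      simp [hkl.ne', h2, not_le.2 hkl]
  · rw [sortedCoord_of_le g (by omega)]
    have : k = l ↔ k ≤ l := by
      constructor
      · rintro rfl; exact le_rfl
      · intro hkl
        have h1 : (k : ℕ) ≤ l := hkl
        exact Fin.ext (by have := l.2; omega)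
    simp [this]

lemma gap_ne_zero (g : SignedPerm n) (k : Fin n) : gap g k ≠ 0 := by
  intro h
  have := gap_faceCenter g k k
  simp [h] at this

/-- The linear functional on a flag cone taking the value `w k` at the centre of the `k`-th face. -/
def flagWeight (w : Fin n → ℝ) (g : SignedPerm n) : (Fin n → ℝ) →ₗ[ℝ] ℝ := ∑ k, w k • gap g k

lemma flagWeight_apply (w : Fin n → ℝ) (g : SignedPerm n) (y : Fin n → ℝ) :
    flagWeight w g y = ∑ k, w k * gap g k y := by
  simp [flagWeight]

lemma flagWeight_ne_zero [NeZero n] {w : Fin n → ℝ} (hw : ∀ k, 0 < w k) (g : SignedPerm n) :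
    flagWeight w g ≠ 0 := by
  intro h
  have h1 : flagWeight w g (faceCenter (flagFace g 0)) = w 0 := by
    simp [flagWeight_apply, gap_faceCenter]
  have := hw 0
  simp [h] at h1
  linarith

/-- The open simplex cut from a flag cone by its weight functional. -/
def openFlagSimplex (w : Fin n → ℝ) (g : SignedPerm n) : Set (Fin n → ℝ) :=
  {y | y ∈ openFlagCone g ∧ flagWeight w g y < 1}

/-- The closed simplex cut from a flag cone by its weight functional. -/
def closedFlagSimplex (w : Fin n → ℝ) (g : SignedPerm n) : Set (Fin n → ℝ) :=
  {y | y ∈ flagCone g ∧ flagWeight w g y ≤ 1}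

lemma volume_closedFlagSimplex_le [NeZero n] {w : Fin n → ℝ} (hw : ∀ k, 0 < w k)
    (g : SignedPerm n) : volume (closedFlagSimplex w g) ≤ volume (openFlagSimplex w g) := by
  have hsub : closedFlagSimplex w g ⊆ openFlagSimplex w g ∪
      ((⋃ k, {y | gap g k y = 0}) ∪ {y | flagWeight w g y = 1}) := by
    intro y hy
    by_cases h1 : ∃ k, gap g k y = 0
    · exact Or.inr (Or.inl (Set.mem_iUnion.2 h1))
    by_cases h2 : flagWeight w g y = 1
    · exact Or.inr (Or.inr h2)
    push Not at h1
    exact Or.inl ⟨fun k => lt_of_le_of_ne (hy.1 k) (h1 k).symm, lt_of_le_of_ne hy.2 h2⟩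
  refine (measure_mono hsub).trans ((measure_union_le _ _).trans ?_)
  have : volume ((⋃ k, {y | gap g k y = 0}) ∪ {y | flagWeight w g y = 1}) = 0 :=
    measure_union_null (measure_iUnion_null fun k => volume_levelSet_eq_zero (gap_ne_zero g k) 0)
      (volume_levelSet_eq_zero (flagWeight_ne_zero hw g) 1)
  rw [this, add_zero]

lemma isOpen_openFlagSimplex (w : Fin n → ℝ) (g : SignedPerm n) : IsOpen (openFlagSimplex w g) := by
  have h : openFlagSimplex w g = (⋂ k, {y | 0 < gap g k y}) ∩ {y | flagWeight w g y < 1} := by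
    ext y; simp [openFlagSimplex, openFlagCone]
  rw [h]
  exact (isOpen_iInter_of_finite fun k =>
    isOpen_lt continuous_const (LinearMap.continuous_of_finiteDimensional _)).inter
    (isOpen_lt (LinearMap.continuous_of_finiteDimensional _) continuous_const)

lemma volume_preserving_sortedCoord (g : SignedPerm n) :
    MeasurePreserving (fun (y : Fin n → ℝ) (j : Fin n) => sortedCoord g j y) := by
  have h1 := volume_measurePreserving_piCongrLeft (fun _ : Fin n => ℝ) g.1.symm
  have h2 : MeasurePreserving (fun (y : Fin n → ℝ) j => ((g.2 (g.1 j) : ℤ) : ℝ) * y j) := by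
    refine volume_preserving_pi (f := fun j x => ((g.2 (g.1 j) : ℤ) : ℝ) * x) fun j => ?_
    rcases Int.units_eq_one_or (g.2 (g.1 j)) with hu | hu
    · simp only [hu, Units.val_one, Int.cast_one, one_mul]
      exact MeasurePreserving.id volume
    · simpa [hu] using Measure.measurePreserving_neg (volume : Measure ℝ)
  have h3 : (fun (y : Fin n → ℝ) (j : Fin n) => sortedCoord g j y)
      = (fun (y : Fin n → ℝ) j => ((g.2 (g.1 j) : ℤ) : ℝ) * y j) ∘
        MeasurableEquiv.piCongrLeft (fun _ : Fin n => ℝ) g.1.symm := by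
    funext y j
    rw [sortedCoord_fin]
    simp [MeasurableEquiv.coe_piCongrLeft, Equiv.piCongrLeft_apply]
  rw [h3]
  exact h2.comp h1

/-- Signed permutations of coordinates preserve volume, so all flags contribute equally. -/
lemma volume_openFlagSimplex (w : Fin n → ℝ) (g : SignedPerm n) :
    volume (openFlagSimplex w g) = volume (openFlagSimplex w 1) := by
  have hs : ∀ (m : ℕ) y, sortedCoord (1 : SignedPerm n) m (fun j => sortedCoord g j y)
      = sortedCoord g m y := by
    intro m y
    by_cases h : m < n
    · have := sortedCoord_fin (1 : SignedPerm n) ⟨m, h⟩ fun j => sortedCoord g j y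
      simpa using this
    · simp [sortedCoord_of_le _ (not_lt.1 h)]
  have hg : ∀ k y, gap (1 : SignedPerm n) k (fun j => sortedCoord g j y) = gap g k y := by
    intro k y
    simp only [gap, LinearMap.sub_apply, hs]
  rw [← (volume_preserving_sortedCoord g).measure_preimage
    (isOpen_openFlagSimplex w 1).measurableSet.nullMeasurableSet]
  congr 1
  ext y
  simp only [openFlagSimplex, openFlagCone, flagWeight_apply, Set.mem_preimage, Set.mem_ofPred_eq, hg]

lemma volume_le_of_subset_iUnion [NeZero n] {w : Fin n → ℝ} (hw : ∀ k, 0 < w k)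
    {B : Set (Fin n → ℝ)} (hB : B ⊆ ⋃ g, closedFlagSimplex w g) :
    volume B ≤ Fintype.card (SignedPerm n) * volume (openFlagSimplex w 1) := by
  refine (measure_mono hB).trans ((measure_iUnion_fintype_le _ _).trans ?_)
  refine (Finset.sum_le_sum fun g _ => (volume_closedFlagSimplex_le hw g).trans
    (volume_openFlagSimplex w g).le).trans ?_
  simp

/-! ### Volume bounds from disjoint images of simplices -/

lemma measurableSet_image_linearMap {f : (Fin n → ℝ) →ₗ[ℝ] (Fin n → ℝ)}
    (hf : LinearMap.det f ≠ 0) {s : Set (Fin n → ℝ)} (hs : MeasurableSet s) :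
    MeasurableSet (f '' s) :=
  (f.equivOfDetNeZero hf).toContinuousLinearEquiv.toHomeomorph.measurableEmbedding.measurableSet_image.2
    hs

/-- The pieces lie in disjoint open cones, and injectivity of the piecewise linear map keeps their
images disjoint inside `L`. -/
lemma sum_volume_le [NeZero n] {X : Face n → Fin n → ℝ} (hinj : Function.Injective (flagMap X))
    (hdet : ∀ g, (flagLinear X g).det ≠ 0) {Q : SignedPerm n → Set (Fin n → ℝ)}
    (hQm : ∀ g, MeasurableSet (Q g)) (hQ : ∀ g, Q g ⊆ openFlagCone g) {L : Set (Fin n → ℝ)}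
    (hL : ∀ g, ∀ y ∈ Q g, flagLinear X g y ∈ L) :
    ∑ g, ENNReal.ofReal |(flagLinear X g).det| * volume (Q g) ≤ volume L := by
  have hsub : (⋃ g, flagLinear X g '' Q g) ⊆ L := by
    refine Set.iUnion_subset fun g => ?_
    rintro _ ⟨y, hy, rfl⟩
    exact hL g y hy
  refine le_trans (le_of_eq ?_) (measure_mono hsub)
  rw [measure_iUnion _ fun g => measurableSet_image_linearMap (hdet g) (hQm g), tsum_fintype]
  · exact Finset.sum_congr rfl fun g _ => (Measure.addHaar_image_linearMap _ _ _).symm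
  · intro g g' hgg'
    refine Set.disjoint_left.2 ?_
    rintro _ ⟨y, hy, rfl⟩ ⟨z, hz, hzy⟩
    rw [← flagMap_eq X (openFlagCone_subset _ (hQ _ hy)),
      ← flagMap_eq X (openFlagCone_subset _ (hQ _ hz))] at hzy
    have := hinj hzy
    subst this
    exact hgg' (openFlagCone_disjoint (hQ _ hy) (hQ _ hz))

lemma Convex.sum_mem_of_sum_le_one {ι E : Type*} [Fintype ι] [AddCommGroup E] [Module ℝ E]
    {L : Set E} (hL : Convex ℝ L) (h0 : 0 ∈ L) {a : ι → ℝ} {z : ι → E} (ha : ∀ i, 0 ≤ a i)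
    (ha1 : ∑ i, a i ≤ 1) (hz : ∀ i, z i ∈ L) : ∑ i, a i • z i ∈ L := by
  have := hL.sum_mem (t := Finset.univ) (w := fun o : Option ι => o.elim (1 - ∑ i, a i) a)
    (z := fun o => o.elim 0 z) (by rintro (_ | i) _ <;> simp [ha, ha1]) (by simp [Fintype.sum_option])
    (by rintro (_ | i) _ <;> simp [h0, hz])
  simpa [Fintype.sum_option] using this

/-- A convex combination: the points `(w k)⁻¹ • X` carry the weights `w k * gap g k y`, and `z`
takes what is left. -/
lemma flagLinear_mem {w : Fin n → ℝ} (hw : ∀ k, 0 < w k) {X : Face n → Fin n → ℝ}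
    {L : Set (Fin n → ℝ)} (hL : Convex ℝ L) (h0 : 0 ∈ L) {g : SignedPerm n}
    (hX : ∀ k, (w k)⁻¹ • X (flagFace g k) ∈ L) {y z : Fin n → ℝ} (hy : y ∈ flagCone g)
    (hy1 : flagWeight w g y ≤ 1) (hz : z ∈ L) :
    flagLinear X g y + (1 - flagWeight w g y) • z ∈ L := by
  have hy0 : 0 ≤ flagWeight w g y := by
    rw [flagWeight_apply]
    exact Finset.sum_nonneg fun k _ => mul_nonneg (hw k).le (hy k)
  have := Convex.sum_mem_of_sum_le_one hL h0
    (a := fun o : Option (Fin n) => o.elim (1 - flagWeight w g y) fun k => w k * gap g k y)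
    (z := fun o => o.elim z fun k => (w k)⁻¹ • X (flagFace g k))
    (by rintro (_ | i) <;> simp [hy1]; exact mul_nonneg (hw i).le (hy i))
    (by simp [Fintype.sum_option, flagWeight_apply])
    (by rintro (_ | i) <;> simp [hz, hX])
  rw [Fintype.sum_option] at this
  convert this using 1
  rw [add_comm]
  congr 1
  rw [flagLinear_apply]
  refine Finset.sum_congr rfl fun k _ => ?_
  have := (hw k).ne'
  simp only [Option.elim_some, smul_smul]
  congr 1
  field_simp

lemma sum_det_mul_volume_le [NeZero n] {w : Fin n → ℝ} (hw : ∀ k, 0 < w k)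
    {X : Face n → Fin n → ℝ} (hinj : Function.Injective (flagMap X))
    (hdet : ∀ g, (flagLinear X g).det ≠ 0) {L : Set (Fin n → ℝ)} (hL : Convex ℝ L) (h0 : 0 ∈ L)
    (hX : ∀ g k, (w k)⁻¹ • X (flagFace g k) ∈ L) :
    ENNReal.ofReal (∑ g, |(flagLinear X g).det|) * volume (openFlagSimplex w 1) ≤ volume L := by
  rw [ENNReal.ofReal_sum_of_nonneg fun _ _ => abs_nonneg _, Finset.sum_mul]
  refine le_trans (le_of_eq ?_) (sum_volume_le hinj hdet (Q := openFlagSimplex w)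
    (fun g => (isOpen_openFlagSimplex w g).measurableSet) (fun g y hy => hy.1) ?_)
  · simp only [volume_openFlagSimplex w]
  · intro g y hy
    simpa using flagLinear_mem hw hL h0 (hX g) (openFlagCone_subset g hy.1) hy.2.le h0

/-- The map folding the flag simplex onto the pyramid between its outer facet and `y`. -/
def pyramidMap (w : Fin n → ℝ) (g : SignedPerm n) (y : Fin n → ℝ) :
    (Fin n → ℝ) →ₗ[ℝ] (Fin n → ℝ) := LinearMap.id - (flagWeight w g).smulRight y

/-- The determinant of a rank-one perturbation of the identity. -/
lemma det_pyramidMap (w : Fin n → ℝ) (g : SignedPerm n) (y : Fin n → ℝ) :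
    (pyramidMap w g y).det = 1 - flagWeight w g y := by
  let v : Fin n → ℝ := fun j => flagWeight w g (Pi.single j 1)
  have h : pyramidMap w g y = Matrix.toLin' (1 + Matrix.replicateCol Unit (-y) *
      Matrix.replicateRow Unit v) := by
    apply LinearMap.toMatrix'.injective
    rw [LinearMap.toMatrix'_toLin']
    ext i j
    simp [LinearMap.toMatrix'_apply, pyramidMap, Matrix.mul_apply, v, Matrix.one_apply,
      Pi.single_apply]
    ring
  rw [h, LinearMap.det_toLin', Matrix.det_one_add_replicateCol_mul_replicateRow]
  have : v ⬝ᵥ y = flagWeight w g y := by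
    conv_rhs => rw [pi_eq_sum_univ' y, map_sum]
    simp only [dotProduct, map_smul, smul_eq_mul]
    refine Finset.sum_congr rfl fun i _ => ?_
    rw [mul_comm]
  rw [dotProduct_neg, this]; ring

/-- The affine map u ↦ u + (1 - w(u)) y fixes the outer facet of the simplex and sends its apex 0 to
`y`. It produces a second simplex in the same cone, beyond that facet, with `η` times the volume;
convexity puts its image in `L`. -/
lemma sum_det_add_mul_volume_le [NeZero n] {w : Fin n → ℝ} (hw : ∀ k, 0 < w k)
    {X : Face n → Fin n → ℝ} (hinj : Function.Injective (flagMap X))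
    (hdet : ∀ g, (flagLinear X g).det ≠ 0) {L : Set (Fin n → ℝ)} (hL : Convex ℝ L) (h0 : 0 ∈ L)
    (hX : ∀ g k, (w k)⁻¹ • X (flagFace g k) ∈ L) {g₀ : SignedPerm n} {y : Fin n → ℝ}
    (hy : y ∈ flagCone g₀) {η : ℝ} (hη : 0 < η) (hyη : flagWeight w g₀ y = 1 + η)
    (hyL : flagMap X y ∈ L) :
    ENNReal.ofReal (∑ g, |(flagLinear X g).det| + η * |(flagLinear X g₀).det|)
      * volume (openFlagSimplex w 1) ≤ volume L := by
  classical
  let P : Set (Fin n → ℝ) := (fun u => y + u) '' (pyramidMap w g₀ y '' openFlagSimplex w g₀)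
  have hPdet : (pyramidMap w g₀ y).det = -η := by rw [det_pyramidMap, hyη]; ring
  have hPm : MeasurableSet P := by
    have := measurableSet_image_linearMap (f := pyramidMap w g₀ y) (by rw [hPdet]; linarith)
      (isOpen_openFlagSimplex w g₀).measurableSet
    exact (Homeomorph.addLeft y).measurableEmbedding.measurableSet_image.2 this
  have hPv : volume P = ENNReal.ofReal η * volume (openFlagSimplex w 1) := by
    simp only [P]
    rw [Set.image_add_left, measure_preimage_add, Measure.addHaar_image_linearMap, hPdet, abs_neg,
      abs_of_pos hη, volume_openFlagSimplex]
  have hPe : ∀ p ∈ P, ∃ u ∈ openFlagSimplex w g₀, p = u + (1 - flagWeight w g₀ u) • y := by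
    rintro _ ⟨_, ⟨u, hu, rfl⟩, rfl⟩
    refine ⟨u, hu, ?_⟩
    simp only [pyramidMap, LinearMap.sub_apply, LinearMap.id_apply, LinearMap.smulRight_apply]
    module
  have hPc : P ⊆ openFlagCone g₀ := by
    intro p hp k
    obtain ⟨u, hu, rfl⟩ := hPe p hp
    rw [map_add, map_smul, smul_eq_mul]
    exact add_pos_of_pos_of_nonneg (hu.1 k) (mul_nonneg (by linarith [hu.2]) (hy k))
  have hdisj : Disjoint (openFlagSimplex w g₀) P := by
    refine Set.disjoint_left.2 fun p hp hp' => ?_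
    obtain ⟨u, hu, rfl⟩ := hPe p hp'
    have := hp.2
    rw [map_add, map_smul, smul_eq_mul, hyη] at this
    have h2 := hu.2
    nlinarith
  have hPL : ∀ p ∈ P, flagLinear X g₀ p ∈ L := by
    intro p hp
    obtain ⟨u, hu, rfl⟩ := hPe p hp
    rw [map_add, map_smul]
    rw [flagMap_eq X hy] at hyL
    exact flagLinear_mem hw hL h0 (hX g₀) (openFlagCone_subset g₀ hu.1) hu.2.le hyL
  let Q : SignedPerm n → Set (Fin n → ℝ) := fun g =>
    openFlagSimplex w g ∪ if g = g₀ then P else ∅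
  have key := sum_volume_le hinj hdet (Q := Q) (L := L) ?_ ?_ ?_
  · refine le_trans (le_of_eq ?_) key
    have hQv : ∀ g, volume (Q g) = volume (openFlagSimplex w 1)
        + if g = g₀ then ENNReal.ofReal η * volume (openFlagSimplex w 1) else 0 := by
      intro g
      by_cases h : g = g₀
      · subst h
        simp only [Q, if_true]
        rw [measure_union hdisj hPm, hPv, volume_openFlagSimplex]
      · simp [Q, h, volume_openFlagSimplex w g]
    simp only [hQv, mul_add, Finset.sum_add_distrib, mul_ite, mul_zero, Finset.sum_ite_eq',
      Finset.mem_univ, if_true]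
    rw [ENNReal.ofReal_add (Finset.sum_nonneg fun _ _ => abs_nonneg _) (by positivity), add_mul,
      ENNReal.ofReal_sum_of_nonneg fun _ _ => abs_nonneg _, Finset.sum_mul,
      ENNReal.ofReal_mul hη.le]
    congr 1
    ring
  · intro g
    refine (isOpen_openFlagSimplex w g).measurableSet.union ?_
    split_ifs
    · exact hPm
    · exact MeasurableSet.empty
  · intro g p hp
    rcases hp with hp | hp
    · exact hp.1
    · split_ifs at hp with h
      · subst h; exact hPc hp
      · exact hp.elim
  · intro g p hp
    rcases hp with hp | hp
    · simpa using flagLinear_mem hw hL h0 (hX g) (openFlagCone_subset g hp.1) hp.2.le h0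
    · split_ifs at hp with h
      · subst h; exact hPL p hp
      · exact hp.elim

/-! ### Polar sets and normalized bodies -/

/-- The polar of a set with respect to the standard dot product. -/
def polarSet (K : Set (Fin n → ℝ)) : Set (Fin n → ℝ) := {ξ | ∀ x ∈ K, x ⬝ᵥ ξ ≤ 1}

lemma zero_mem_polarSet (K : Set (Fin n → ℝ)) : 0 ∈ polarSet K := fun x _ => by simp

lemma convex_polarSet (K : Set (Fin n → ℝ)) : Convex ℝ (polarSet K) := by
  intro ξ hξ ζ hζ a b ha hb hab x hx
  rw [dotProduct_add, dotProduct_smul, dotProduct_smul, smul_eq_mul, smul_eq_mul]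
  nlinarith [hξ x hx, hζ x hx]

lemma isClosed_polarSet (K : Set (Fin n → ℝ)) : IsClosed (polarSet K) := by
  have : polarSet K = ⋂ x ∈ K, {ξ | x ⬝ᵥ ξ ≤ 1} := by ext; simp [polarSet]
  rw [this]
  refine isClosed_biInter fun x _ => isClosed_le ?_ continuous_const
  unfold dotProduct
  fun_prop

/-- The bipolar theorem, in contrapositive form. -/
lemma exists_mem_polarSet_of_notMem {K : Set (Fin n → ℝ)} (hc : IsClosed K) (hK : Convex ℝ K)
    (h0 : 0 ∈ K) {z : Fin n → ℝ} (hz : z ∉ K) : ∃ ξ ∈ polarSet K, 1 < z ⬝ᵥ ξ := by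
  obtain ⟨f, u, hu, huz⟩ := geometric_hahn_banach_closed_point hK hc hz
  have hu0 : 0 < u := by simpa using hu 0 h0
  have hf : ∀ x, x ⬝ᵥ (fun i => u⁻¹ * f (Pi.single i 1)) = u⁻¹ * f x := by
    intro x
    conv_rhs => rw [pi_eq_sum_univ' x, map_sum]
    rw [dotProduct, Finset.mul_sum]
    refine Finset.sum_congr rfl fun i _ => ?_
    rw [map_smul, smul_eq_mul]
    ring
  refine ⟨fun i => u⁻¹ * f (Pi.single i 1), fun x hx => ?_, ?_⟩
  · rw [hf, inv_mul_le_iff₀ hu0]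
    linarith [hu x hx]
  · rw [hf, lt_inv_mul_iff₀ hu0]
    linarith

/-- A symmetric convex body inscribed in the cube, touching all its facets at their centres, whose
polar is within a factor `1 + δ` of the cross-polytope. -/
structure IsNearCube (K : Set (Fin n → ℝ)) (δ : ℝ) : Prop where
  convex : Convex ℝ K
  isClosed : IsClosed K
  neg_mem : ∀ x ∈ K, -x ∈ K
  norm_le : ∀ x ∈ K, ‖x‖ ≤ 1
  single_mem : ∀ i, Pi.single i 1 ∈ K
  polar_le : ∀ ξ ∈ polarSet K, ∑ i, |ξ i| ≤ 1 + δ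

lemma IsNearCube.zero_mem [NeZero n] {K : Set (Fin n → ℝ)} {δ : ℝ} (hK : IsNearCube K δ) :
    0 ∈ K := by
  have h1 := hK.single_mem 0
  have := hK.convex h1 (hK.neg_mem _ h1) (a := 1 / 2) (b := 1 / 2) (by norm_num) (by norm_num)
    (by norm_num)
  simpa using this

lemma mem_polarSet_of_sum_abs_le {K : Set (Fin n → ℝ)} (hK : ∀ x ∈ K, ‖x‖ ≤ 1) {ξ : Fin n → ℝ}
    (hξ : ∑ i, |ξ i| ≤ 1) : ξ ∈ polarSet K := by
  intro x hx
  refine le_trans (Finset.sum_le_sum fun i _ => ?_) hξ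
  have h1 : |x i| ≤ 1 := (norm_le_pi_norm x i).trans (hK x hx)
  calc x i * ξ i ≤ |x i| * |ξ i| := by rw [← abs_mul]; exact le_abs_self _
    _ ≤ 1 * |ξ i| := by gcongr
    _ = |ξ i| := one_mul _

/-- The sum is the one-sided derivative at `t = 0` of a product that never exceeds its initial value
1. -/
lemma sum_nonpos_of_prod_le_one {ι : Type*} (s : Finset ι) (a : ι → ℝ) {A : ℝ} (hA : 0 < A)
    (ha : ∀ i, |a i| ≤ A)
    (h : ∀ t, 0 < t → t ≤ 1 → t * A ≤ 1 → ∏ i ∈ s, (1 + t * a i) ≤ 1) : ∑ i ∈ s, a i ≤ 0 := by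
  by_contra! hs
  set S := ∑ i ∈ s, a i
  -- The last bound makes the quadratic error at most half of the linear term `t * S`.
  set t := min (min 1 A⁻¹) (S / (2 * (4 ^ s.card * A ^ 2)))
  have ht : 0 < t := by positivity
  have ht1 : t ≤ 1 := (min_le_left _ _).trans (min_le_left _ _)
  have htA : t * A ≤ 1 := by
    have : t ≤ A⁻¹ := (min_le_left _ _).trans (min_le_right _ _)
    calc t * A ≤ A⁻¹ * A := by gcongr
      _ = 1 := inv_mul_cancel₀ hA.ne'
  have h1 := abs_prod_one_add_sub_le s (a := fun i => t * a i) htA (fun i => by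
    rw [abs_mul, abs_of_pos ht]; gcongr; exact ha i)
  rw [← Finset.mul_sum] at h1
  have h2 := (abs_le.1 h1).1
  have h3 := h t ht ht1 htA
  have h4 : t * S ≤ 4 ^ s.card * (t * A) ^ 2 := by linarith
  have h5 : S ≤ 4 ^ s.card * A ^ 2 * t := by
    refine le_of_mul_le_mul_left ?_ ht
    linarith [h4]
  have h6 : t ≤ S / (2 * (4 ^ s.card * A ^ 2)) := min_le_right _ _
  rw [le_div_iff₀ (by positivity)] at h6
  linarith

/-! ### Dual pairs near face centres, by maximizing products of coordinates -/

/-- The codimension of a face. -/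
def faceCodim (F : Face n) : ℕ := (Finset.univ.filter fun i => F i ≠ 0).card

lemma faceCenter_ne_zero_iff (F : Face n) (i : Fin n) : faceCenter F i ≠ 0 ↔ F i ≠ 0 := by
  unfold faceCenter
  cases F i <;> simp

lemma faceCenter_mul_self {F : Face n} {i : Fin n} (h : F i ≠ 0) :
    faceCenter F i * faceCenter F i = 1 := by
  unfold faceCenter
  revert h
  cases F i <;> simp

lemma abs_faceCenter {F : Face n} {i : Fin n} (h : F i ≠ 0) : |faceCenter F i| = 1 := by
  unfold faceCenter
  revert h
  cases F i <;> simp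

lemma faceCenter_eq_zero {F : Face n} {i : Fin n} (h : F i = 0) : faceCenter F i = 0 := by
  simp [faceCenter, h]

lemma sum_abs_faceCenter (F : Face n) : ∑ i, |faceCenter F i| = faceCodim F := by
  rw [faceCodim, Finset.card_filter, Nat.cast_sum]
  refine Finset.sum_congr rfl fun i _ => ?_
  by_cases h : F i = 0
  · simp [h, faceCenter_eq_zero h]
  · simp [h, abs_faceCenter h]

lemma faceCenter_dotProduct_self (F : Face n) : faceCenter F ⬝ᵥ faceCenter F = faceCodim F := by
  rw [← sum_abs_faceCenter]
  refine Finset.sum_congr rfl fun i _ => ?_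
  by_cases h : F i = 0
  · simp [faceCenter_eq_zero h]
  · rw [abs_faceCenter h, faceCenter_mul_self h]

/-- The product of the coordinates of a dual point in the directions of a face. -/
def faceProd (F : Face n) (ξ : Fin n → ℝ) : ℝ :=
  ∏ i ∈ Finset.univ.filter (fun i => F i ≠ 0), faceCenter F i * ξ i

/-- The ℓ¹ bound gives compactness. The centre divided by the codimension competes with a positive
product, so no signed coordinate of the maximizer vanishes. -/
lemma exists_isMaxOn_faceProd {K : Set (Fin n → ℝ)} {δ : ℝ} (hK : IsNearCube K δ) (F : Face n)
    (hF : 0 < faceCodim F) : ∃ ξ ∈ polarSet K, (∀ i, F i ≠ 0 → 0 < faceCenter F i * ξ i) ∧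
      ∀ ζ ∈ polarSet K, (∀ i, F i ≠ 0 → 0 ≤ faceCenter F i * ζ i) → faceProd F ζ ≤ faceProd F ξ := by
  have hk : (0 : ℝ) < faceCodim F := by exact_mod_cast hF
  let C : Set (Fin n → ℝ) := polarSet K ∩ ⋂ i, {ζ | F i ≠ 0 → 0 ≤ faceCenter F i * ζ i}
  have hCc : IsClosed C := by
    refine (isClosed_polarSet K).inter (isClosed_iInter fun i => ?_)
    by_cases h : F i = 0
    · simp [h]
    · simp only [ne_eq, h, not_false_eq_true, true_imp_iff]
      exact isClosed_le continuous_const (by fun_prop)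
  have hCb : Bornology.IsBounded C := by
    refine (Metric.isBounded_iff_subset_closedBall 0).2 ⟨1 + δ, fun ζ hζ => ?_⟩
    have h1 := hK.polar_le ζ hζ.1
    rw [mem_closedBall_zero_iff]
    refine (pi_norm_le_iff_of_nonneg
      ((Finset.sum_nonneg fun _ _ => abs_nonneg _).trans h1)).2 fun i => ?_
    exact (Finset.single_le_sum (f := fun i => |ζ i|) (fun _ _ => abs_nonneg _)
      (Finset.mem_univ i)).trans h1
  have hcent : (faceCodim F : ℝ)⁻¹ • faceCenter F ∈ C := by
    refine ⟨mem_polarSet_of_sum_abs_le hK.norm_le ?_, Set.mem_iInter.2 fun i hi => ?_⟩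
    · simp only [Pi.smul_apply, smul_eq_mul, abs_mul, abs_inv, Nat.abs_cast]
      rw [← Finset.mul_sum, sum_abs_faceCenter, inv_mul_cancel₀ hk.ne']
    · simp only [Pi.smul_apply, smul_eq_mul]
      rw [mul_left_comm, faceCenter_mul_self hi]
      positivity
  obtain ⟨ξ, hξC, hmax⟩ := (Metric.isCompact_of_isClosed_isBounded hCc hCb).exists_isMaxOn
    ⟨_, hcent⟩ (f := faceProd F) (by unfold faceProd; fun_prop)
  have hpos : 0 < faceProd F ξ := by
    refine lt_of_lt_of_le ?_ (hmax hcent)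
    refine Finset.prod_pos fun i hi => ?_
    simp only [Pi.smul_apply, smul_eq_mul]
    rw [mul_left_comm, faceCenter_mul_self (by simpa using hi)]
    positivity
  have hnn : ∀ i, F i ≠ 0 → 0 ≤ faceCenter F i * ξ i := fun i => Set.mem_iInter.1 hξC.2 i
  refine ⟨ξ, hξC.1, fun i hi => ?_, fun ζ hζ hζ0 => hmax ⟨hζ, Set.mem_iInter.2 hζ0⟩⟩
  refine lt_of_le_of_ne (hnn i hi) fun h0 => hpos.ne' ?_
  exact Finset.prod_eq_zero (by simpa using hi) h0.symm

/-- The optimality condition for the maximal product. -/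
lemma sum_div_le_faceCodim {K : Set (Fin n → ℝ)} {F : Face n}
    {ξ : Fin n → ℝ} (hξ : ξ ∈ polarSet K) (hpos : ∀ i, F i ≠ 0 → 0 < faceCenter F i * ξ i)
    (hmax : ∀ ζ ∈ polarSet K, (∀ i, F i ≠ 0 → 0 ≤ faceCenter F i * ζ i) →
      faceProd F ζ ≤ faceProd F ξ) {ζ : Fin n → ℝ} (hζ : ζ ∈ polarSet K) :
    ∑ i ∈ Finset.univ.filter (fun i => F i ≠ 0), ζ i / ξ i ≤ faceCodim F := by
  have hne : ∀ i, F i ≠ 0 → ξ i ≠ 0 := fun i hi h => by simpa [h] using hpos i hi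
  -- On the segment from ξ to ζ each signed coordinate is multiplied by `1 + t * (ζ i / ξ i - 1)`,
  -- so maximality bounds the product of these factors by 1. The sum in `A` keeps the factors
  -- nonnegative when `t * A ≤ 1`; the extra 1 makes `A` positive.
  have key := sum_nonpos_of_prod_le_one (Finset.univ.filter fun i => F i ≠ 0)
    (fun i => ζ i / ξ i - 1) (A := ∑ i, |ζ i / ξ i - 1| + 1) (by positivity)
    (fun i => (Finset.single_le_sum (f := fun i => |ζ i / ξ i - 1|) (fun _ _ => abs_nonneg _)
      (Finset.mem_univ i)).trans (by simp)) ?_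
  · rw [Finset.sum_sub_distrib] at key
    simp only [Finset.sum_const, nsmul_eq_mul, mul_one] at key
    unfold faceCodim
    linarith
  · intro t ht ht1 htA
    have hcoord : ∀ i, F i ≠ 0 → faceCenter F i * ((1 - t) • ξ + t • ζ) i
        = (faceCenter F i * ξ i) * (1 + t * (ζ i / ξ i - 1)) := by
      intro i hi
      have := hne i hi
      simp only [Pi.add_apply, Pi.smul_apply, smul_eq_mul]
      field_simp
      ring
    have hfac : ∀ i, 0 ≤ 1 + t * (ζ i / ξ i - 1) := by
      intro i
      have h1 : |ζ i / ξ i - 1| ≤ ∑ i, |ζ i / ξ i - 1| + 1 :=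
        (Finset.single_le_sum (f := fun i => |ζ i / ξ i - 1|) (fun _ _ => abs_nonneg _)
          (Finset.mem_univ i)).trans (by simp)
      have h2 : t * |ζ i / ξ i - 1| ≤ 1 := (mul_le_mul_of_nonneg_left h1 ht.le).trans htA
      have h3 := neg_abs_le (t * (ζ i / ξ i - 1))
      rw [abs_mul, abs_of_pos ht] at h3
      linarith
    have h1 := hmax ((1 - t) • ξ + t • ζ)
      (convex_polarSet K hξ hζ (by linarith) ht.le (by ring)) (fun i hi => by
        rw [hcoord i hi]
        exact mul_nonneg (hpos i hi).le (hfac i))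
    have h2 : faceProd F ((1 - t) • ξ + t • ζ) = faceProd F ξ *
        ∏ i ∈ Finset.univ.filter (fun i => F i ≠ 0), (1 + t * (ζ i / ξ i - 1)) := by
      unfold faceProd
      rw [← Finset.prod_mul_distrib]
      exact Finset.prod_congr rfl fun i hi => hcoord i (by simpa using hi)
    rw [h2] at h1
    have h3 : 0 < faceProd F ξ := Finset.prod_pos fun i hi => hpos i (by simpa using hi)
    exact le_of_mul_le_mul_left (by linarith) h3

/-- Polar pairs of points of the body and its polar, close to the centres of dual faces. -/
structure IsFacePair (K : Set (Fin n → ℝ)) (δ : ℝ) (F : Face n) (x ξ : Fin n → ℝ) : Prop where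
  mem : x ∈ K
  mem_polar : ξ ∈ polarSet K
  dotProduct_eq : F ≠ 0 → x ⬝ᵥ ξ = 1
  norm_sub_le : ‖x - faceCenter F‖ ≤ n * δ
  norm_polar_sub_le : ‖(faceCodim F : ℝ) • ξ - faceCenter F‖ ≤ n * δ
  sum_abs_sub_le : ∑ i, |ξ i - (faceCodim F : ℝ)⁻¹ * faceCenter F i| ≤ δ
  eq_center : faceCodim F = 1 → x = faceCenter F ∧ ξ = faceCenter F

lemma faceCodim_le (F : Face n) : faceCodim F ≤ n :=
  (Finset.card_filter_le _ _).trans (by simp)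

/-- By optimality the point with coordinates 1 / (k ξ_i) on the support pairs to at most 1 with the
whole polar, so it lies in `K` by the bipolar theorem. As `K` is inside the cube, k |ξ_i| ≥ 1 there,
and the ℓ¹ budget 1 + δ leaves only δ for the total deviation from the centre. -/
lemma exists_isFacePair_of_one_lt [NeZero n] {K : Set (Fin n → ℝ)} {δ : ℝ}
    (hK : IsNearCube K δ) (F : Face n) (hF : 1 < faceCodim F) : ∃ x ξ, IsFacePair K δ F x ξ := by
  obtain ⟨ξ, hξ, hpos, hmax⟩ := exists_isMaxOn_faceProd hK F (by omega)
  have hk : (0 : ℝ) < faceCodim F := by exact_mod_cast (by omega : 0 < faceCodim F)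
  have hkn : (faceCodim F : ℝ) ≤ n := by exact_mod_cast faceCodim_le F
  set k : ℝ := (faceCodim F : ℝ) with hkdef
  let x : Fin n → ℝ := fun i => if F i = 0 then 0 else (k * ξ i)⁻¹
  have hdot : ∀ ζ : Fin n → ℝ, x ⬝ᵥ ζ
      = k⁻¹ * ∑ i ∈ Finset.univ.filter (fun i => F i ≠ 0), ζ i / ξ i := by
    intro ζ
    rw [Finset.mul_sum, Finset.sum_filter, dotProduct]
    refine Finset.sum_congr rfl fun i _ => ?_
    by_cases h : F i = 0
    · simp [x, h]
    · simp only [x, h, if_false, ne_eq, not_false_eq_true, if_true, mul_inv]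
      ring
  have hne : ∀ i, F i ≠ 0 → ξ i ≠ 0 := fun i hi h => by simpa [h] using hpos i hi
  have hxK : x ∈ K := by
    by_contra hx
    obtain ⟨ζ, hζ, hlt⟩ := exists_mem_polarSet_of_notMem hK.isClosed hK.convex hK.zero_mem hx
    rw [hdot, lt_inv_mul_iff₀ hk, mul_one] at hlt
    exact absurd (sum_div_le_faceCodim hξ hpos hmax hζ) (not_le.2 hlt)
  have hge : ∀ i, F i ≠ 0 → 1 ≤ k * (faceCenter F i * ξ i) := by
    intro i hi
    have h1 : |x i| ≤ 1 := (norm_le_pi_norm x i).trans (hK.norm_le x hxK)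
    have h2 : |ξ i| = faceCenter F i * ξ i := by
      rw [← abs_of_pos (hpos i hi), abs_mul, abs_faceCenter hi, one_mul]
    simp only [x, hi, if_false, abs_inv, abs_mul, abs_of_pos hk, h2] at h1
    exact (inv_le_one₀ (mul_pos hk (hpos i hi))).1 h1
  -- On the support ξ has the sign of the centre and at least its scaled size, so deviations are
  -- differences of absolute values and add up exactly.
  have habs : ∀ i, |ξ i - k⁻¹ * faceCenter F i| = |ξ i| - k⁻¹ * |faceCenter F i| := by
    intro i
    by_cases hi : F i = 0
    · simp [faceCenter_eq_zero hi]
    · have h1 : ξ i = faceCenter F i * (faceCenter F i * ξ i) := by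
        rw [← mul_assoc, faceCenter_mul_self hi, one_mul]
      have h2 : ξ i - k⁻¹ * faceCenter F i = faceCenter F i * (faceCenter F i * ξ i - k⁻¹) := by
        rw [mul_sub, ← h1]; ring
      have h3 : k⁻¹ ≤ faceCenter F i * ξ i := by
        rw [inv_le_iff_one_le_mul₀ hk]; linarith [hge i hi]
      rw [h2, abs_mul, abs_faceCenter hi, one_mul, mul_one, abs_of_nonneg (by linarith)]
      congr 1
      rw [← abs_of_pos (hpos i hi), abs_mul, abs_faceCenter hi, one_mul]
  have hsum : ∑ i, |ξ i - k⁻¹ * faceCenter F i| ≤ δ := by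
    simp only [habs, Finset.sum_sub_distrib]
    rw [← Finset.mul_sum, sum_abs_faceCenter, inv_mul_cancel₀ hk.ne']
    linarith [hK.polar_le ξ hξ]
  have hsingle : ∀ i, |ξ i - k⁻¹ * faceCenter F i| ≤ δ := fun i =>
    (Finset.single_le_sum (f := fun i => |ξ i - k⁻¹ * faceCenter F i|) (fun _ _ => abs_nonneg _)
      (Finset.mem_univ i)).trans hsum
  have hδ : 0 ≤ δ := (abs_nonneg _).trans (hsingle 0)
  refine ⟨x, ξ, hxK, hξ, fun _ => ?_, ?_, ?_, hsum, fun h => by omega⟩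
  · rw [hdot, Finset.sum_congr rfl (g := fun _ => (1 : ℝ))
      (fun i hi => div_self (hne i (by simpa using hi)))]
    simp only [Finset.sum_const, nsmul_eq_mul, mul_one]
    exact inv_mul_cancel₀ hk.ne'
  · refine (pi_norm_le_iff_of_nonneg (by positivity)).2 fun i => ?_
    by_cases hi : F i = 0
    · simp only [Pi.sub_apply, x, hi, if_true, faceCenter_eq_zero hi, sub_self, norm_zero]
      positivity
    · set p := k * (faceCenter F i * ξ i) with hp
      have h1 := hge i hi
      have h2 : x i - faceCenter F i = faceCenter F i * (p⁻¹ - 1) := by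
        have h3 := hne i hi
        have h4 : faceCenter F i ≠ 0 := (faceCenter_ne_zero_iff F i).2 hi
        simp only [x, hi, if_false, hp]
        field_simp
      have h3 : p - 1 ≤ k * δ := by
        have h4 := hsingle i
        rw [habs i, abs_faceCenter hi, mul_one] at h4
        have h5 : |ξ i| = faceCenter F i * ξ i := by
          rw [← abs_of_pos (hpos i hi), abs_mul, abs_faceCenter hi, one_mul]
        rw [h5] at h4
        have h6 := mul_le_mul_of_nonneg_left h4 hk.le
        rw [mul_sub, mul_inv_cancel₀ hk.ne'] at h6
        exact h6
      have hp0 : 0 < p := by linarith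
      have h4 : p⁻¹ ≤ 1 := inv_le_one_of_one_le₀ h1
      have h5 : 1 - p⁻¹ ≤ p - 1 := by
        have : p⁻¹ * p = 1 := inv_mul_cancel₀ hp0.ne'
        nlinarith [sq_nonneg (p - 1), inv_pos.2 hp0]
      rw [Pi.sub_apply, h2, Real.norm_eq_abs, abs_mul, abs_faceCenter hi, one_mul, abs_sub_comm,
        abs_of_nonneg (by linarith)]
      have : k * δ ≤ n * δ := by gcongr
      linarith
  · refine (pi_norm_le_iff_of_nonneg (by positivity)).2 fun i => ?_
    have h1 : (k • ξ - faceCenter F) i = k * (ξ i - k⁻¹ * faceCenter F i) := by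
      simp only [Pi.sub_apply, Pi.smul_apply, smul_eq_mul]
      field_simp
    rw [h1, Real.norm_eq_abs, abs_mul, abs_of_pos hk]
    exact mul_le_mul hkn (hsingle i) (abs_nonneg _) (by positivity)

/-- The zero sign vector is a dummy case, absent from every flag. A facet uses its own centre twice,
as `K` touches it there; smaller faces use the maximizer. -/
lemma exists_isFacePair [NeZero n] {K : Set (Fin n → ℝ)} {δ : ℝ} (hδ : 0 ≤ δ)
    (hK : IsNearCube K δ) (F : Face n) : ∃ x ξ, IsFacePair K δ F x ξ := by
  have hnδ : 0 ≤ n * δ := by positivity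
  rcases Nat.lt_trichotomy (faceCodim F) 1 with h | h | h
  · have h0 : F = 0 := by
      have : faceCodim F = 0 := by omega
      rw [faceCodim, Finset.card_eq_zero, Finset.filter_eq_empty_iff] at this
      ext1 i
      simpa using this (Finset.mem_univ i)
    have hc : faceCenter F = 0 := by ext i; exact faceCenter_eq_zero (congrFun h0 i)
    refine ⟨0, 0, hK.zero_mem, zero_mem_polarSet K, fun hF => absurd h0 hF, ?_, ?_, ?_,
      fun _ => ⟨hc.symm, hc.symm⟩⟩ <;> simp [hc, hδ, hnδ]
  · obtain ⟨i, hi⟩ := Finset.card_eq_one.1 h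
    have hFi : F i ≠ 0 := by
      have : i ∈ Finset.univ.filter fun i => F i ≠ 0 := by rw [hi]; simp
      simpa using this
    have hFj : ∀ j, j ≠ i → F j = 0 := by
      intro j hj
      by_contra hne
      have : j ∈ Finset.univ.filter fun i => F i ≠ 0 := by simpa using hne
      rw [hi] at this
      exact hj (by simpa using this)
    have hmem : faceCenter F ∈ K := by
      have hc : faceCenter F = faceCenter F i • Pi.single i (1 : ℝ) := by
        ext j
        by_cases hj : j = i
        · subst hj; simp
        · simp [hj, faceCenter_eq_zero (hFj j hj)]
      rw [hc]
      rcases mul_self_eq_one_iff.1 (faceCenter_mul_self hFi) with h1 | h1 <;> rw [h1]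
      · simpa using hK.single_mem i
      · simpa using hK.neg_mem _ (hK.single_mem i)
    refine ⟨faceCenter F, faceCenter F, hmem, mem_polarSet_of_sum_abs_le hK.norm_le ?_, fun _ => ?_,
      ?_, ?_, ?_, fun _ => ⟨rfl, rfl⟩⟩
    · rw [sum_abs_faceCenter, h]; simp
    · rw [faceCenter_dotProduct_self, h]; simp
    · simpa using hnδ
    · simpa [h] using hnδ
    · simpa [h] using hδ
  · exact exists_isFacePair_of_one_lt hK F h

/-! ### Bijectivity of the perturbed map, and flag weights as norms -/

lemma flagMap_injective [NeZero n] {X : Face n → Fin n → ℝ} {ε : ℝ}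
    (hX : ∀ F, ‖X F - faceCenter F‖ ≤ ε) (hε : 2 * 3 ^ n * ε < 1) :
    Function.Injective (flagMap X) := by
  intro y z hyz
  have h := norm_flagMap_sub_le hX y z
  rw [hyz, sub_self, zero_sub, norm_neg] at h
  by_contra hne
  have : 0 < ‖y - z‖ := norm_pos_iff.2 (sub_ne_zero.2 hne)
  nlinarith

/-- A perturbation of the identity with Lipschitz constant below 1 is onto. -/
lemma flagMap_surjective [NeZero n] {X : Face n → Fin n → ℝ} {ε : ℝ}
    (hX : ∀ F, ‖X F - faceCenter F‖ ≤ ε) (hε0 : 0 ≤ ε) (hε : 2 * 3 ^ n * ε < 1) :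
    Function.Surjective (flagMap X) := by
  have happ : ApproximatesLinearOn (flagMap X)
      ((ContinuousLinearEquiv.refl ℝ (Fin n → ℝ)) : (Fin n → ℝ) →L[ℝ] (Fin n → ℝ)) Set.univ
      (2 * 3 ^ n * ε).toNNReal := by
    intro y _ z _
    rw [Real.coe_toNNReal _ (by positivity)]
    simpa using norm_flagMap_sub_le hX y z
  refine happ.surjective (Or.inr ?_)
  rw [← NNReal.coe_lt_coe, Real.coe_toNNReal _ (by positivity)]
  simpa using hε

lemma flagLinear_faceCenter_flagFace (X : Face n → Fin n → ℝ) (g : SignedPerm n) (l : Fin n) :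
    flagLinear X g (faceCenter (flagFace g l)) = X (flagFace g l) := by
  simp [flagLinear_apply, gap_faceCenter]

lemma faceCenter_flagFace_mem (g : SignedPerm n) (l : Fin n) :
    faceCenter (flagFace g l) ∈ flagCone g := by
  intro k
  rw [gap_faceCenter]
  split_ifs <;> simp

lemma flagWeight_faceCenter (w : Fin n → ℝ) (g : SignedPerm n) (l : Fin n) :
    flagWeight w g (faceCenter (flagFace g l)) = w l := by
  simp [flagWeight_apply, gap_faceCenter]

lemma faceCodim_flagFace (g : SignedPerm n) (k : Fin n) : faceCodim (flagFace g k) = k + 1 := by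
  have h : (Finset.univ.filter fun i => flagFace g k i ≠ 0) = (Finset.Iic k).map g.1.toEmbedding := by
    ext i
    obtain ⟨j, rfl⟩ := g.1.surjective i
    simp [flagFace, unitSign_ne_zero]
  rw [faceCodim, h]
  simp

/-- Unit weights telescope to the largest sorted coordinate, so the corresponding simplices fill the
cube. -/
lemma flagWeight_one [NeZero n] {g : SignedPerm n} {y : Fin n → ℝ} (hy : y ∈ flagCone g) :
    flagWeight (fun _ => 1) g y = ‖y‖ := by
  have h1 : flagWeight (fun _ => 1) g y = sortedCoord g ((0 : Fin n) : ℕ) y := by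
    rw [← sum_gap_ge, flagWeight_apply]
    simp
  rw [h1]
  apply le_antisymm
  · rw [sortedCoord_eq_abs hy]
    exact norm_le_pi_norm y _
  · refine (pi_norm_le_iff_of_nonneg (sortedCoord_nonneg hy _)).2 fun i => ?_
    obtain ⟨j, rfl⟩ := g.1.surjective i
    rw [Real.norm_eq_abs, ← sortedCoord_eq_abs hy]
    exact sortedCoord_antitone hy (by simp)

/-- The `k`-th gap enters each of the first `k + 1` sorted coordinates once; these simplices fill
the cross-polytope. -/
lemma flagWeight_succ {g : SignedPerm n} {y : Fin n → ℝ} (hy : y ∈ flagCone g) :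
    flagWeight (fun k => (k : ℝ) + 1) g y = ∑ i, |y i| := by
  rw [← Equiv.sum_comp g.1, flagWeight_apply]
  simp only [← sortedCoord_eq_abs hy, ← sum_gap_ge]
  rw [Finset.sum_comm]
  refine Finset.sum_congr rfl fun k _ => ?_
  rw [← Finset.sum_filter, Finset.sum_const, nsmul_eq_mul]
  have : (Finset.univ.filter fun j => j ≤ k) = Finset.Iic k := by ext; simp
  rw [this, Fin.card_Iic]
  push_cast
  ring

/-- The cube in `Fin n → ℝ`. -/
def cubeSet (n : ℕ) : Set (Fin n → ℝ) := {y | ‖y‖ ≤ 1}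

/-- The cross-polytope in `Fin n → ℝ`. -/
def crossSet (n : ℕ) : Set (Fin n → ℝ) := {y | ∑ i, |y i| ≤ 1}

lemma volume_cubeSet_le [NeZero n] : volume (cubeSet n)
    ≤ Fintype.card (SignedPerm n) * volume (openFlagSimplex (fun _ : Fin n => 1) 1) := by
  refine volume_le_of_subset_iUnion (fun _ => one_pos) fun y hy => ?_
  obtain ⟨g, hg⟩ := exists_mem_flagCone y
  exact Set.mem_iUnion.2 ⟨g, hg, (flagWeight_one hg).trans_le hy⟩

lemma volume_crossSet_le [NeZero n] : volume (crossSet n) ≤ Fintype.card (SignedPerm n)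
    * volume (openFlagSimplex (fun k : Fin n => (k : ℝ) + 1) 1) := by
  refine volume_le_of_subset_iUnion (fun _ => by positivity) fun y hy => ?_
  obtain ⟨g, hg⟩ := exists_mem_flagCone y
  exact Set.mem_iUnion.2 ⟨g, hg, (flagWeight_succ hg).trans_le hy⟩

/-! ### First-order cancellation and a gain of order δ -/

lemma abs_flagTrace_le {X : Face n → Fin n → ℝ} {ε : ℝ} (hX : ∀ F, ‖X F - faceCenter F‖ ≤ ε)
    (g : SignedPerm n) : |flagTrace X g| ≤ 2 * n * ε := by
  refine (Finset.abs_sum_le_sum_abs _ _).trans ((Finset.sum_le_sum (g := fun _ => 2 * ε)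
    fun k _ => (abs_gap_le _ _ _).trans ?_).trans ?_)
  · linarith [hX (flagFace g k)]
  · simp; apply le_of_eq; ring

lemma dotProduct_le_norm_mul_sum (x y : Fin n → ℝ) : x ⬝ᵥ y ≤ ‖x‖ * ∑ i, |y i| := by
  rw [dotProduct, Finset.mul_sum]
  refine Finset.sum_le_sum fun i _ => ?_
  refine (le_abs_self _).trans ?_
  rw [abs_mul]
  exact mul_le_mul_of_nonneg_right (norm_le_pi_norm x i) (abs_nonneg _)

/-- The first-order terms of the two volumes cancel for polar pairs. -/
lemma neg_le_sum_flagTrace_add {K : Set (Fin n → ℝ)} {δ : ℝ}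
    {x ξ : Face n → Fin n → ℝ} (h : ∀ F, IsFacePair K δ F (x F) (ξ F)) (hδ : 0 ≤ δ) :
    -(Fintype.card (SignedPerm n) * (n * (n * δ * δ)))
      ≤ ∑ g, flagTrace x g + ∑ g, flagTrace (fun F => (faceCodim F : ℝ) • ξ F) g := by
  rw [sum_flagTrace, sum_flagTrace, ← Finset.sum_add_distrib]
  -- With m = k + 1, x · ξ = 1 and c · c = m, the two terms add up exactly to -(x - c) · (ξ - c /
  -- m), a pairing of two displacements of order δ.
  have hterm : ∀ (g : SignedPerm n) (k : Fin n), -(n * δ * δ) ≤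
      ((k : ℝ) + 1)⁻¹ * (faceCenter (flagFace g k) ⬝ᵥ (x (flagFace g k) - faceCenter (flagFace g k)))
      + ((k : ℝ) + 1)⁻¹ * (faceCenter (flagFace g k) ⬝ᵥ
        ((faceCodim (flagFace g k) : ℝ) • ξ (flagFace g k) - faceCenter (flagFace g k))) := by
    intro g k
    have hF := h (flagFace g k)
    set F := flagFace g k
    have hcod : (faceCodim F : ℝ) = (k : ℝ) + 1 := by
      rw [faceCodim_flagFace]; push_cast; rfl
    have hk : (0 : ℝ) < (k : ℝ) + 1 := by positivity
    have hF0 : F ≠ 0 := by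
      intro h0
      have : faceCodim F = 0 := by rw [h0]; simp [faceCodim]
      rw [this] at hcod
      simp at hcod
      linarith
    have hb : (x F - faceCenter F) ⬝ᵥ (ξ F - ((k : ℝ) + 1)⁻¹ • faceCenter F) ≤ n * δ * δ := by
      refine (dotProduct_le_norm_mul_sum _ _).trans ?_
      refine mul_le_mul hF.norm_sub_le ?_ (Finset.sum_nonneg fun _ _ => abs_nonneg _) (by positivity)
      have := hF.sum_abs_sub_le
      rw [hcod] at this
      simpa using this
    have e1 := hF.dotProduct_eq hF0
    have e2 : faceCenter F ⬝ᵥ faceCenter F = (k : ℝ) + 1 := by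
      rw [faceCenter_dotProduct_self, hcod]
    have e3 : faceCenter F ⬝ᵥ x F = x F ⬝ᵥ faceCenter F := dotProduct_comm _ _
    simp only [sub_dotProduct, dotProduct_sub, dotProduct_smul, smul_eq_mul, e1, e2, hcod, e3]
      at hb ⊢
    have e4 : ((k : ℝ) + 1)⁻¹ * ((k : ℝ) + 1) = 1 := inv_mul_cancel₀ hk.ne'
    have e5 : ((k : ℝ) + 1)⁻¹ * (((k : ℝ) + 1) * (faceCenter F ⬝ᵥ ξ F)) = faceCenter F ⬝ᵥ ξ F := by
      rw [← mul_assoc, e4, one_mul]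
    rw [mul_sub, mul_sub, e4, e5]
    linarith
  calc -(Fintype.card (SignedPerm n) * (n * (n * δ * δ)))
      = ∑ g : SignedPerm n, ∑ k : Fin n, -(n * δ * δ) := by
        rw [Finset.sum_const, Finset.sum_const, Finset.card_univ, Finset.card_univ,
          Fintype.card_fin, nsmul_eq_mul, nsmul_eq_mul]
        ring
    _ ≤ _ := by
        refine Finset.sum_le_sum fun g _ => ?_
        rw [← Finset.sum_add_distrib]
        exact Finset.sum_le_sum fun k _ => hterm g k

/-- Either the body or its polar exceeds its inscribed star body by an amount of order `δ`. -/
lemma exists_gain [NeZero n] {K : Set (Fin n → ℝ)} {δ : ℝ} (hK : IsNearCube K δ) (hδ : 0 < δ)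
    (hδ1 : 32 * n * (2 * 3 ^ n * (n * δ)) ≤ 1) {ξ₀ : Fin n → ℝ} (hξ₀ : ξ₀ ∈ polarSet K)
    (hξ₀1 : ∑ i, |ξ₀ i| = 1 + δ) {x ξ : Face n → Fin n → ℝ}
    (h : ∀ F, IsFacePair K δ F (x F) (ξ F)) :
    (∃ g, ∃ y ∈ flagCone g, flagWeight (fun _ => 1) g y = 1 + δ / 16 ∧ flagMap x y ∈ K) ∨
    ∃ η, δ / 16 ≤ η ∧ ∃ g, ∃ y ∈ flagCone g, flagWeight (fun k => (k : ℝ) + 1) g y = 1 + η ∧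
      flagMap (fun F => (faceCodim F : ℝ) • ξ F) y ∈ polarSet K := by
  have hn1 : (1 : ℝ) ≤ n := by exact_mod_cast NeZero.one_le
  set lam : ℝ := 2 * 3 ^ n * (n * δ) with hlam
  have h3 : (1 : ℝ) ≤ 3 ^ n := one_le_pow₀ (by norm_num)
  have hlam0 : 0 < lam := by positivity
  have hnδ : 32 * n * (n * δ) ≤ 1 / 2 := by
    have : 2 * (n * δ) ≤ lam := by rw [hlam]; nlinarith [mul_pos (by linarith : (0:ℝ) < n) hδ]
    nlinarith
  have hδn : 32 * (n * δ) ≤ 1 / 2 := by nlinarith [mul_pos (by linarith : (0:ℝ) < n) hδ]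
  have hδs : 32 * δ ≤ 1 / 2 := by nlinarith
  have hlams : 32 * lam ≤ 1 := by nlinarith
  choose e he using fun i => exists_unit_mul_eq_abs (ξ₀ i)
  let top : Fin n := ⟨n - 1, by have := NeZero.pos n; omega⟩
  have htop : ∀ j : Fin n, j ≤ top := fun j => by rw [Fin.le_def]; simp only [top]; omega
  -- The vertex with the signs of `ξ₀`, where the excess of `ξ₀` is felt; `d j` is the deficit of
  -- its substitute `x v` in coordinate `j`.
  let v : Face n := fun i => unitSign (e i)
  have hv : ∀ i, faceCenter v i = ((e i : ℤ) : ℝ) := fun i => unitSign_cast (e i)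
  set d : Fin n → ℝ := fun j => 1 - ((e j : ℤ) : ℝ) * x v j with hd
  have hxv1 : ∀ j, |((e j : ℤ) : ℝ) * x v j| ≤ 1 := by
    intro j
    rw [abs_mul, abs_unit, one_mul]
    exact (norm_le_pi_norm (x v) j).trans (hK.norm_le _ (h v).mem)
  have hd0 : ∀ j, 0 ≤ d j := fun j => by
    have := (abs_le.1 (hxv1 j)).2
    simp only [hd]; linarith
  have hdx : ∀ j, faceCenter v j - x v j = ((e j : ℤ) : ℝ) * d j := by
    intro j
    rw [hv]
    simp only [hd]
    linear_combination (x v j) * unit_mul_self (e j)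
  have hdn : ∀ j, d j ≤ n * δ := by
    intro j
    have h1 := (norm_le_pi_norm (x v - faceCenter v) j).trans (h v).norm_sub_le
    rw [Pi.sub_apply, norm_sub_rev, hdx, Real.norm_eq_abs, abs_mul, abs_unit, one_mul] at h1
    exact (le_abs_self _).trans h1
  -- If all deficits were below δ / 2, then `x v ⬝ᵥ ξ₀` would be at least (1 + δ)(1 - δ / 2) > 1.
  obtain ⟨i, hi⟩ : ∃ i, δ / 2 ≤ d i := by
    by_contra! hlt
    have h1 : x v ⬝ᵥ ξ₀ ≤ 1 := hξ₀ _ (h v).mem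
    have h2 : x v ⬝ᵥ ξ₀ = ∑ j, (|ξ₀ j| - d j * |ξ₀ j|) := by
      refine Finset.sum_congr rfl fun j _ => ?_
      rw [← he j]
      simp only [hd]
      linear_combination (-(x v j * ξ₀ j)) * unit_mul_self (e j)
    rw [h2, Finset.sum_sub_distrib, hξ₀1] at h1
    have h3 : ∑ j, d j * |ξ₀ j| ≤ ∑ j, δ / 2 * |ξ₀ j| :=
      Finset.sum_le_sum fun j _ => mul_le_mul_of_nonneg_right (hlt j).le (abs_nonneg _)
    rw [← Finset.mul_sum, hξ₀1] at h3
    nlinarith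
  -- Any flag from the facet in direction `i` to the vertex `v` will do.
  let g : SignedPerm n := (Equiv.swap 0 i, e)
  have hg0 : g.1 0 = i := by simp [g]
  have hgtop : flagFace g top = v := by
    ext1 j
    simp [flagFace, htop, v, g]
  set f : Face n := flagFace g 0 with hf
  have hfcod : faceCodim f = 1 := by rw [hf, faceCodim_flagFace]; simp
  have hfc : ∀ j, faceCenter f j = if j = i then ((e i : ℤ) : ℝ) else 0 := by
    intro j
    obtain ⟨m, rfl⟩ := g.1.surjective j
    have h1 : m ≤ 0 ↔ g.1 m = i := by
      rw [← hg0, g.1.injective.eq_iff]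
      exact ⟨fun h => le_antisymm h (by simp), fun h => h.le⟩
    rw [hf, faceCenter_flagFace]
    simp only [h1]
    split_ifs with h2
    · rw [h2]
    · rfl
  have hxf : x f = faceCenter f := ((h f).eq_center hfcod).1
  have hξf : ξ f = faceCenter f := ((h f).eq_center hfcod).2
  let y : Fin n → ℝ := ((1 + δ / 16) / 2) • (faceCenter f + faceCenter v)
  have hyc : y ∈ flagCone g := by
    intro k
    have h1 := faceCenter_flagFace_mem g 0 k
    have h2 := faceCenter_flagFace_mem g top k
    rw [hgtop] at h2
    simp only [y, map_smul, map_add, smul_eq_mul]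
    exact mul_nonneg (by positivity) (add_nonneg h1 h2)
  have hyw : flagWeight (fun _ => 1) g y = 1 + δ / 16 := by
    have h1 := flagWeight_faceCenter (fun _ => 1) g 0
    have h2 := flagWeight_faceCenter (fun _ => 1) g top
    rw [hgtop] at h2
    simp only [y, map_smul, map_add, smul_eq_mul]
    rw [h1, h2]; ring
  have hyx : flagMap x y = ((1 + δ / 16) / 2) • (x f + x v) := by
    have h1 := flagLinear_faceCenter_flagFace x g 0
    have h2 := flagLinear_faceCenter_flagFace x g top
    rw [hgtop] at h2
    rw [flagMap_eq x hyc]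
    simp only [y, map_smul, map_add]
    rw [h1, h2]
  by_cases hyK : flagMap x y ∈ K
  · exact Or.inl ⟨g, y, hyc, hyw, hyK⟩
  right
  -- If the enlarged midpoint of `x f` and `x v` is outside `K`, a separating ζ is almost 1 at both
  -- points. Since `x f` is the facet centre, ζ is concentrated on coordinate `i`, and the deficit
  -- `d i` of `x v` forces the ℓ¹ norm of ζ above 1 by order δ.
  obtain ⟨ζ, hζ, hlt⟩ := exists_mem_polarSet_of_notMem hK.isClosed hK.convex hK.zero_mem hyK
  have hζsum := hK.polar_le ζ hζ
  have ha1 : x f ⬝ᵥ ζ ≤ 1 := hζ _ (h f).mem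
  have hb1 : x v ⬝ᵥ ζ ≤ 1 := hζ _ (h v).mem
  rw [hyx, smul_dotProduct, add_dotProduct, smul_eq_mul] at hlt
  have hab : 2 - δ / 8 ≤ x f ⬝ᵥ ζ + x v ⬝ᵥ ζ := by nlinarith
  have hxfζ : x f ⬝ᵥ ζ = ((e i : ℤ) : ℝ) * ζ i := by
    rw [hxf, dotProduct]
    simp [hfc]
  set a : ℝ := ((e i : ℤ) : ℝ) * ζ i with ha
  rw [hxfζ] at ha1 hab
  have hai : |ζ i| = a := by
    have h1 : 0 ≤ a := by linarith
    rw [← abs_of_nonneg h1, ha, abs_mul, abs_unit, one_mul]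
  have hrest : ∑ j ∈ Finset.univ.erase i, |ζ j| ≤ 2 * δ := by
    have := Finset.add_sum_erase Finset.univ (fun j => |ζ j|) (Finset.mem_univ i)
    linarith
  have hζbig : 1 + δ / 4 ≤ ∑ j, |ζ j| := by
    have h1 : faceCenter v ⬝ᵥ ζ ≤ ∑ j, |ζ j| := by
      refine Finset.sum_le_sum fun j _ => ?_
      refine (le_abs_self _).trans ?_
      rw [abs_mul, hv, abs_unit, one_mul]
    have h2 : faceCenter v ⬝ᵥ ζ = x v ⬝ᵥ ζ + ∑ j, ((e j : ℤ) : ℝ) * d j * ζ j := by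
      rw [dotProduct, dotProduct, ← Finset.sum_add_distrib]
      refine Finset.sum_congr rfl fun j _ => ?_
      rw [← hdx]; ring
    have h3 := Finset.add_sum_erase Finset.univ (fun j => ((e j : ℤ) : ℝ) * d j * ζ j)
      (Finset.mem_univ i)
    have h4 : -(n * δ * (2 * δ)) ≤ ∑ j ∈ Finset.univ.erase i, ((e j : ℤ) : ℝ) * d j * ζ j := by
      have h5 : ∑ j ∈ Finset.univ.erase i, -(n * δ * |ζ j|)
          ≤ ∑ j ∈ Finset.univ.erase i, ((e j : ℤ) : ℝ) * d j * ζ j := by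
        refine Finset.sum_le_sum fun j _ => ?_
        refine le_trans ?_ (neg_abs_le _)
        rw [abs_mul, abs_mul, abs_unit, one_mul, abs_of_nonneg (hd0 j), neg_le_neg_iff]
        exact mul_le_mul_of_nonneg_right (hdn j) (abs_nonneg _)
      refine le_trans ?_ h5
      rw [Finset.sum_neg_distrib, ← Finset.mul_sum, neg_le_neg_iff]
      exact mul_le_mul_of_nonneg_left hrest (by positivity)
    have h6 : ((e i : ℤ) : ℝ) * d i * ζ i = d i * a := by rw [ha]; ring
    rw [h6] at h3
    have h7 : δ / 2 * (1 - δ / 8) ≤ d i * a := by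
      have : 1 - δ / 8 ≤ a := by linarith
      exact mul_le_mul hi this (by linarith) (hd0 i)
    nlinarith
  set Y : Face n → Fin n → ℝ := fun F => (faceCodim F : ℝ) • ξ F with hY
  have hYn : ∀ F, ‖Y F - faceCenter F‖ ≤ n * δ := fun F => (h F).norm_polar_sub_le
  obtain ⟨u, hu⟩ := flagMap_surjective hYn (by positivity) (by linarith) ζ
  -- The facet centre is fixed by the polar map and is O(δ) away from ζ. Anchoring the Lipschitz
  -- estimate there makes the distance from ζ to its preimage O(δ²), so the excess in ℓ¹ norm
  -- survives.
  set p : Fin n → ℝ := faceCenter f with hp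
  have hpp : flagMap Y p = p := by
    rw [flagMap_eq Y (faceCenter_flagFace_mem g 0), hp, hf, flagLinear_faceCenter_flagFace, ← hf, hY]
    simp [hfcod, hξf, hp]
  have hclose := norm_flagMap_sub_le hYn u p
  rw [hu, hpp, ← hlam] at hclose
  have hζp : ‖ζ - p‖ ≤ 2 * δ := by
    refine (pi_norm_le_iff_of_nonneg (by positivity)).2 fun j => ?_
    rw [Pi.sub_apply, hfc]
    split_ifs with hj
    · subst hj
      have h1 : ζ j - ((e j : ℤ) : ℝ) = ((e j : ℤ) : ℝ) * (a - 1) := by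
        rw [ha]; linear_combination (-ζ j) * unit_mul_self (e j)
      rw [h1, Real.norm_eq_abs, abs_mul, abs_unit, one_mul, abs_le]
      constructor <;> linarith
    · rw [sub_zero, Real.norm_eq_abs]
      exact (Finset.single_le_sum (f := fun j => |ζ j|) (fun _ _ => abs_nonneg _)
        (Finset.mem_erase.2 ⟨hj, Finset.mem_univ j⟩)).trans hrest
  have hup : ‖u - p‖ ≤ 4 * δ := by
    have h1 : ‖u - p‖ ≤ ‖ζ - p‖ + ‖ζ - p - (u - p)‖ := by
      calc ‖u - p‖ = ‖(ζ - p) - (ζ - p - (u - p))‖ := by congr 1; abel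
        _ ≤ _ := norm_sub_le _ _
    nlinarith [norm_nonneg (u - p)]
  have hζu : ∀ j, |ζ j| - 4 * lam * δ ≤ |u j| := by
    intro j
    have h1 : |ζ j - u j| ≤ 4 * lam * δ := by
      refine (abs_sub_le_norm ζ u j).trans ?_
      have : ζ - p - (u - p) = ζ - u := by abel
      rw [this] at hclose
      nlinarith
    have h2 := abs_sub_abs_le_abs_sub (ζ j) (u j)
    linarith
  have husum : 1 + δ / 8 ≤ ∑ j, |u j| := by
    have h1 := Finset.sum_le_sum fun j (_ : j ∈ Finset.univ) => hζu j
    rw [Finset.sum_sub_distrib, Finset.sum_const, Finset.card_univ, Fintype.card_fin,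
      nsmul_eq_mul] at h1
    nlinarith
  obtain ⟨g', hg'⟩ := exists_mem_flagCone u
  refine ⟨∑ j, |u j| - 1, by linarith, g', u, hg', ?_, by rw [hu]; exact hζ⟩
  rw [flagWeight_succ hg']; ring

/-- Write the lower bounds as M + a and M + b. Then a + b ≥ δ / 32 - O(δ²) while ab ≥ -O(δ²), so M
(a + b) + ab > 0 for small δ. -/
lemma sq_lt_mul_of_first_order_cancel {M C δ T T' s s' A B : ℝ} (hM : 1 ≤ M) (hC : 1 ≤ C)
    (hδ : 0 < δ) (hδC : 1000 * C ^ 2 * δ ≤ 1) (hT : |T| ≤ C * δ) (hT' : |T'| ≤ C * δ)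
    (hTT : -(C * δ ^ 2) ≤ T + T') (hs : 0 ≤ s) (hs' : 0 ≤ s') (hss : s + s' = δ / 32)
    (hA : M + T - C * δ ^ 2 + s ≤ A) (hB : M + T' - C * δ ^ 2 + s' ≤ B) : M ^ 2 < A * B := by
  have hCδ : 1000 * (C * δ) ≤ 1 := by
    have : C * δ ≤ C ^ 2 * δ := by
      have := mul_pos (by linarith : 0 < C) hδ
      nlinarith
    linarith
  have hδ1 : δ ≤ C * δ := by nlinarith
  have hCδ2 : C * δ ^ 2 ≤ C * δ := by nlinarith [mul_pos (by linarith : 0 < C) hδ]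
  have key : ∀ T s : ℝ, |T| ≤ C * δ → 0 ≤ s → s ≤ δ / 32 →
      |T - C * δ ^ 2 + s| ≤ 3 * (C * δ) := by
    intro T s hT h0 h1
    rw [abs_le] at *
    have : 0 ≤ C * δ ^ 2 := by positivity
    constructor <;> linarith [hT.1, hT.2]
  have ha := key T s hT hs (by linarith)
  have hb := key T' s' hT' hs' (by linarith)
  set a := T - C * δ ^ 2 + s with ha'
  set b := T' - C * δ ^ 2 + s' with hb'
  have hab : -(9 * (C * δ) ^ 2) ≤ a * b := by
    have h1 : |a * b| ≤ 3 * (C * δ) * (3 * (C * δ)) := by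
      rw [abs_mul]
      exact mul_le_mul ha hb (abs_nonneg _) (by positivity)
    have := (abs_le.1 h1).1
    nlinarith
  have hsum : δ / 32 - 3 * (C * δ ^ 2) ≤ a + b := by
    rw [ha', hb']; linarith
  have hquad : 3 * (C * δ ^ 2) ≤ 3 * (C ^ 2 * δ) * δ := by nlinarith [sq_nonneg δ]
  have hpos : 0 ≤ δ / 32 - 3 * (C * δ ^ 2) := by nlinarith
  have h1 : M ^ 2 < (M + a) * (M + b) := by
    have h2 : δ / 32 - 3 * (C * δ ^ 2) ≤ M * (a + b) := by nlinarith
    have h3 : 9 * (C * δ) ^ 2 < δ / 32 - 3 * (C * δ ^ 2) := by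
      have : 9 * (C * δ) ^ 2 = 9 * (C ^ 2 * δ) * δ := by ring
      nlinarith
    nlinarith
  have hMa : 0 ≤ M + a := by linarith [(abs_le.1 ha).1]
  have hMb : 0 ≤ M + b := by linarith [(abs_le.1 hb).1]
  refine h1.trans_le (mul_le_mul ?_ ?_ hMb ?_)
  · rw [ha']; linarith
  · rw [hb']; linarith
  · rw [ha'] at hMa; linarith

/-! ### Strict inequality for bodies in normalized position -/

lemma cubeSet_eq : cubeSet n = Metric.closedBall 0 1 := by
  ext y; simp [cubeSet]

lemma volume_cubeSet_ne_zero : volume (cubeSet n) ≠ 0 := by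
  rw [cubeSet_eq]
  exact (Metric.measure_closedBall_pos _ _ one_pos).ne'

lemma volume_crossSet_ne_zero [NeZero n] : volume (crossSet n) ≠ 0 := by
  have hn : (0 : ℝ) < n := by exact_mod_cast NeZero.pos n
  have hsub : Metric.closedBall (0 : Fin n → ℝ) (n : ℝ)⁻¹ ⊆ crossSet n := by
    intro y hy
    rw [mem_closedBall_zero_iff] at hy
    refine (Finset.sum_le_sum fun i _ => (norm_le_pi_norm y i).trans hy).trans ?_
    simp [hn.ne']
  exact ((Metric.measure_closedBall_pos volume (0 : Fin n → ℝ) (inv_pos.2 hn)).trans_le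
    (measure_mono hsub)).ne'

lemma norm_le_sum_abs (y : Fin n → ℝ) : ‖y‖ ≤ ∑ i, |y i| :=
  (pi_norm_le_iff_of_nonneg (Finset.sum_nonneg fun _ _ => abs_nonneg _)).2 fun i =>
    Finset.single_le_sum (f := fun i => |y i|) (fun _ _ => abs_nonneg _) (Finset.mem_univ i)

lemma volume_openFlagSimplex_one_ne_top [NeZero n] :
    volume (openFlagSimplex (fun _ : Fin n => 1) 1) ≠ ⊤ := by
  refine ne_top_of_le_ne_top (measure_closedBall_lt_top (x := (0 : Fin n → ℝ)) (r := 1)).ne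
    (measure_mono fun y hy => ?_)
  rw [mem_closedBall_zero_iff, ← flagWeight_one (openFlagCone_subset _ hy.1)]
  exact hy.2.le

lemma volume_openFlagSimplex_succ_ne_top :
    volume (openFlagSimplex (fun k : Fin n => (k : ℝ) + 1) 1) ≠ ⊤ := by
  refine ne_top_of_le_ne_top (measure_closedBall_lt_top (x := (0 : Fin n → ℝ)) (r := 1)).ne
    (measure_mono fun y hy => ?_)
  rw [mem_closedBall_zero_iff]
  refine (norm_le_sum_abs y).trans ?_
  rw [← flagWeight_succ (openFlagCone_subset _ hy.1)]
  exact hy.2.le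

/-- A strict form of local minimality of the cube for bodies in normalized position. -/
theorem exists_volume_lt_of_isNearCube (n : ℕ) [NeZero n] : ∃ δ₀ : ℝ, 0 < δ₀ ∧
    ∀ (δ : ℝ) (K : Set (Fin n → ℝ)), 0 < δ → δ ≤ δ₀ → IsNearCube K δ →
      (∃ ξ₀ ∈ polarSet K, ∑ i, |ξ₀ i| = 1 + δ) →
      volume (cubeSet n) * volume (crossSet n) < volume K * volume (polarSet K) := by
  have hn1 : (1 : ℝ) ≤ n := by exact_mod_cast NeZero.one_le
  set M : ℝ := (Fintype.card (SignedPerm n) : ℝ) with hMdef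
  have hM : 1 ≤ M := by
    rw [hMdef]
    exact_mod_cast Fintype.card_pos
  set C₀ : ℝ := n.factorial * 4 ^ n * (2 * n * n) ^ 2 with hC₀
  have hC₀0 : 0 ≤ C₀ := by positivity
  set C : ℝ := M * (C₀ + 2 * n * n + 1) with hC
  have hC1 : C₀ + 2 * n * n + 1 ≤ C := by
    have : 0 ≤ C₀ + 2 * n * n + 1 := by positivity
    nlinarith
  have hCone : 1 ≤ C := by
    have : (0 : ℝ) ≤ 2 * n * n := by positivity
    linarith
  -- The first bound keeps the piecewise linear maps bijective and serves the gain estimate; the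
  -- second makes the quadratic errors smaller than the gain.
  refine ⟨min (1 / (32 * n * (2 * 3 ^ n * n))) (1 / (1000 * C ^ 2)), by positivity, ?_⟩
  intro δ K hδ hδ₀ hK ⟨ξ₀, hξ₀, hξ₀1⟩
  have hδ1 : 32 * n * (2 * 3 ^ n * (n * δ)) ≤ 1 := by
    have := hδ₀.trans (min_le_left _ _)
    rw [le_div_iff₀ (by positivity)] at this
    linarith
  have hδC : 1000 * C ^ 2 * δ ≤ 1 := by
    have := hδ₀.trans (min_le_right _ _)
    rw [le_div_iff₀ (by positivity)] at this
    linarith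
  have hCδ : 1000 * (C * δ) ≤ 1 := by
    have : C * δ ≤ C ^ 2 * δ := by
      have := mul_pos (by linarith : 0 < C) hδ
      nlinarith
    linarith
  have hδle : δ ≤ 1 := by nlinarith
  have h3 : (1 : ℝ) ≤ 3 ^ n := one_le_pow₀ (by norm_num)
  have hnδ : 2 * 3 ^ n * (n * δ) < 1 := by
    have : 0 ≤ 2 * 3 ^ n * (n * δ) := by positivity
    nlinarith
  have hεn : 2 * n * (n * δ) ≤ 1 := by
    have h4 : (2 * n * n + 0) * δ ≤ C * δ := by
      refine mul_le_mul_of_nonneg_right ?_ hδ.le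
      linarith
    linarith
  choose x ξ h using exists_isFacePair hδ.le hK
  set Y : Face n → Fin n → ℝ := fun F => (faceCodim F : ℝ) • ξ F with hY
  have hx : ∀ F, ‖x F - faceCenter F‖ ≤ n * δ := fun F => (h F).norm_sub_le
  have hYn : ∀ F, ‖Y F - faceCenter F‖ ≤ n * δ := fun F => (h F).norm_polar_sub_le
  have hTle : ∀ X : Face n → Fin n → ℝ, (∀ F, ‖X F - faceCenter F‖ ≤ n * δ) →
      ∀ g, |flagTrace X g| ≤ 2 * n * n * δ := fun X hX g => by
    have := abs_flagTrace_le hX g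
    linarith
  have hdet : ∀ X : Face n → Fin n → ℝ, (∀ F, ‖X F - faceCenter F‖ ≤ n * δ) →
      ∀ g, 1 + flagTrace X g - C₀ * δ ^ 2 ≤ (flagLinear X g).det := fun X hX g => by
    have h1 := (abs_le.1 (abs_det_flagLinear_sub_le (by positivity) hεn hX g)).1
    have h2 : n.factorial * 4 ^ n * (2 * n * (n * δ)) ^ 2 = C₀ * δ ^ 2 := by rw [hC₀]; ring
    rw [h2] at h1
    linarith
  have hhalf : ∀ X : Face n → Fin n → ℝ, (∀ F, ‖X F - faceCenter F‖ ≤ n * δ) →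
      ∀ g, 1 / 2 ≤ (flagLinear X g).det := fun X hX g => by
    have h1 := hdet X hX g
    have h2 := (abs_le.1 (hTle X hX g)).1
    have h4 : C₀ * δ ^ 2 ≤ C₀ * δ := mul_le_mul_of_nonneg_left (by nlinarith) hC₀0
    have h5 : (C₀ + 2 * n * n + 1) * δ ≤ C * δ := mul_le_mul_of_nonneg_right hC1 hδ.le
    linarith
  have hsum : ∀ X : Face n → Fin n → ℝ, (∀ F, ‖X F - faceCenter F‖ ≤ n * δ) →
      M + ∑ g, flagTrace X g - C * δ ^ 2 ≤ ∑ g, |(flagLinear X g).det| := fun X hX => by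
    have h1 : ∑ g : SignedPerm n, (1 + flagTrace X g - C₀ * δ ^ 2) ≤ ∑ g, |(flagLinear X g).det| :=
      Finset.sum_le_sum fun g _ => (hdet X hX g).trans (le_abs_self _)
    refine le_trans ?_ h1
    simp only [Finset.sum_add_distrib, Finset.sum_sub_distrib, Finset.sum_const, Finset.card_univ,
      nsmul_eq_mul, mul_one]
    rw [← hMdef]
    have h2 : M * C₀ * δ ^ 2 ≤ C * δ ^ 2 := by
      refine mul_le_mul_of_nonneg_right ?_ (by positivity)
      rw [hC]
      have : 0 ≤ M * (2 * n * n + 1) := by positivity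
      linarith
    linarith
  have hTsum : ∀ X : Face n → Fin n → ℝ, (∀ F, ‖X F - faceCenter F‖ ≤ n * δ) →
      |∑ g, flagTrace X g| ≤ C * δ := fun X hX => by
    refine (Finset.abs_sum_le_sum_abs _ _).trans
      ((Finset.sum_le_sum fun g _ => hTle X hX g).trans ?_)
    rw [Finset.sum_const, Finset.card_univ, nsmul_eq_mul, ← hMdef, ← mul_assoc]
    refine mul_le_mul_of_nonneg_right ?_ hδ.le
    rw [hC]
    have : 0 ≤ M * (C₀ + 1) := by positivity
    linarith
  have hTT : -(C * δ ^ 2) ≤ ∑ g, flagTrace x g + ∑ g, flagTrace Y g := by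
    refine le_trans ?_ (neg_le_sum_flagTrace_add h hδ.le)
    rw [← hMdef, neg_le_neg_iff]
    have : 0 ≤ M * (C₀ + n * n + 1) * δ ^ 2 := by positivity
    rw [hC]
    linarith
  have hne : ∀ X : Face n → Fin n → ℝ, (∀ F, ‖X F - faceCenter F‖ ≤ n * δ) →
      ∀ g, (flagLinear X g).det ≠ 0 := fun X hX g => by
    have := hhalf X hX g
    linarith
  have hxK : ∀ (g : SignedPerm n) (k : Fin n), (1 : ℝ)⁻¹ • x (flagFace g k) ∈ K := fun g k => by
    simpa using (h (flagFace g k)).mem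
  have hYK : ∀ (g : SignedPerm n) (k : Fin n), ((k : ℝ) + 1)⁻¹ • Y (flagFace g k) ∈ polarSet K := by
    intro g k
    have h1 : ((k : ℝ) + 1) ≠ 0 := by positivity
    have h2 : ((k : ℝ) + 1)⁻¹ • Y (flagFace g k) = ξ (flagFace g k) := by
      simp only [hY, faceCodim_flagFace, smul_smul]
      push_cast
      rw [inv_mul_cancel₀ h1, one_smul]
    rw [h2]
    exact (h (flagFace g k)).mem_polar
  set V₁ := volume (openFlagSimplex (fun _ : Fin n => 1) 1) with hV₁
  set V₂ := volume (openFlagSimplex (fun k : Fin n => (k : ℝ) + 1) 1) with hV₂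
  have hinjx := flagMap_injective hx hnδ
  have hinjY := flagMap_injective hYn hnδ
  have hfin : ∀ A B : ℝ, M ^ 2 < A * B → 0 ≤ A → ENNReal.ofReal A * V₁ ≤ volume K →
      ENNReal.ofReal B * V₂ ≤ volume (polarSet K) →
      volume (cubeSet n) * volume (crossSet n) < volume K * volume (polarSet K) := by
    intro A B hAB hA h1 h2
    have hc1 := volume_cubeSet_le (n := n)
    have hc2 := volume_crossSet_le (n := n)
    have hV₁0 : V₁ ≠ 0 := fun h0 => by
      rw [← hV₁, h0, mul_zero] at hc1
      exact volume_cubeSet_ne_zero (nonpos_iff_eq_zero.1 hc1)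
    have hV₂0 : V₂ ≠ 0 := fun h0 => by
      rw [← hV₂, h0, mul_zero] at hc2
      exact volume_crossSet_ne_zero (nonpos_iff_eq_zero.1 hc2)
    have hMof : (Fintype.card (SignedPerm n) : ENNReal) = ENNReal.ofReal M := by
      rw [hMdef, ENNReal.ofReal_natCast]
    rw [hMof] at hc1 hc2
    calc volume (cubeSet n) * volume (crossSet n)
        ≤ (ENNReal.ofReal M * V₁) * (ENNReal.ofReal M * V₂) := mul_le_mul' hc1 hc2
      _ = ENNReal.ofReal (M ^ 2) * (V₁ * V₂) := by
          rw [sq, ENNReal.ofReal_mul (by linarith)]; ring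
      _ < ENNReal.ofReal (A * B) * (V₁ * V₂) := by
          refine (ENNReal.mul_lt_mul_iff_left (mul_ne_zero hV₁0 hV₂0) (ENNReal.mul_ne_top
            volume_openFlagSimplex_one_ne_top volume_openFlagSimplex_succ_ne_top)).2 ?_
          exact (ENNReal.ofReal_lt_ofReal_iff (lt_of_le_of_lt (sq_nonneg M) hAB)).2 hAB
      _ = (ENNReal.ofReal A * V₁) * (ENNReal.ofReal B * V₂) := by
          rw [ENNReal.ofReal_mul hA]; ring
      _ ≤ _ := mul_le_mul' h1 h2
  have hnn : ∀ X : Face n → Fin n → ℝ, 0 ≤ ∑ g, |(flagLinear X g).det| := fun X =>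
    Finset.sum_nonneg fun _ _ => abs_nonneg _
  -- Determinants are at least 1 / 2, so a pyramid of relative height δ / 16 is worth δ / 32.
  have hgain : ∀ X : Face n → Fin n → ℝ, (∀ F, ‖X F - faceCenter F‖ ≤ n * δ) → ∀ η g,
      δ / 16 ≤ η → δ / 32 ≤ η * |(flagLinear X g).det| := fun X hX η g hη => by
    have h1 := (hhalf X hX g).trans (le_abs_self _)
    nlinarith
  rcases exists_gain hK hδ hδ1 hξ₀ hξ₀1 h with ⟨g, y, hy, hyw, hyK⟩ | ⟨η, hη, g, y, hy, hyw, hyK⟩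
  · have hg := hgain x hx (δ / 16) g le_rfl
    refine hfin (∑ g, |(flagLinear x g).det| + δ / 16 * |(flagLinear x g).det|)
      (∑ g, |(flagLinear Y g).det|) ?_ (by have := hnn x; linarith) ?_ ?_
    · exact sq_lt_mul_of_first_order_cancel (s := δ / 32) (s' := 0) hM hCone hδ hδC (hTsum x hx)
        (hTsum Y hYn) hTT (by positivity) le_rfl (by ring) (by linarith [hsum x hx])
        (by linarith [hsum Y hYn])
    · exact sum_det_add_mul_volume_le (fun _ => one_pos) hinjx (hne x hx) hK.convex hK.zero_mem hxK
        hy (by positivity) hyw hyK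
    · exact sum_det_mul_volume_le (fun _ => by positivity) hinjY (hne Y hYn) (convex_polarSet K)
        (zero_mem_polarSet K) hYK
  · have hg := hgain Y hYn η g hη
    refine hfin (∑ g, |(flagLinear x g).det|)
      (∑ g, |(flagLinear Y g).det| + η * |(flagLinear Y g).det|) ?_ (hnn x) ?_ ?_
    · exact sq_lt_mul_of_first_order_cancel (s := 0) (s' := δ / 32) hM hCone hδ hδC (hTsum x hx)
        (hTsum Y hYn) hTT le_rfl (by positivity) (by ring) (by linarith [hsum x hx])
        (by linarith [hsum Y hYn])
    · exact sum_det_mul_volume_le (fun _ => one_pos) hinjx (hne x hx) hK.convex hK.zero_mem hxK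
    · exact sum_det_add_mul_volume_le (fun _ => by positivity) hinjY (hne Y hYn) (convex_polarSet K)
        (zero_mem_polarSet K) hYK hy (by linarith) hyw hyK

/-! ### Normalizing the position by maximizing a determinant -/

lemma abs_det_le_prod_sum (A : Matrix (Fin n) (Fin n) ℝ) : |A.det| ≤ ∏ i, ∑ j, |A i j| := by
  rw [← Matrix.det_transpose, Matrix.det_apply']
  refine (Finset.abs_sum_le_sum_abs _ _).trans ?_
  have h1 : ∀ σ : Equiv.Perm (Fin n),
      |((Equiv.Perm.sign σ : ℤ) : ℝ) * ∏ i, A.transpose (σ i) i| = ∏ i, |A i (σ i)| := by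
    intro σ
    rw [abs_mul, abs_unit, one_mul, Finset.abs_prod]
    rfl
  simp only [h1]
  -- The product of the row sums expands over all functions; the permutations are some of the terms.
  rw [Finset.prod_univ_sum, Fintype.piFinset_univ]
  refine (Finset.sum_map Finset.univ ⟨fun σ : Equiv.Perm (Fin n) => (σ : Fin n → Fin n),
    DFunLike.coe_injective⟩ fun f => ∏ i, |A i (f i)|).symm.le.trans ?_
  exact Finset.sum_le_sum_of_subset_of_nonneg (Finset.subset_univ _) fun _ _ _ =>
    Finset.prod_nonneg fun _ _ => abs_nonneg _

lemma sum_abs_single (k : Fin n) : ∑ j, |(Pi.single k (1 : ℝ) : Fin n → ℝ) j| = 1 := by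
  simp [Pi.single_apply, apply_ite abs]

lemma abs_det_updateRow_single_le {A : Matrix (Fin n) (Fin n) ℝ} {r : ℝ} (hr : 1 ≤ r)
    (hA : ∀ i, ∑ j, |A i j| ≤ r) (i k : Fin n) :
    |(A.updateRow i (Pi.single k 1)).det| ≤ r ^ n := by
  refine (abs_det_le_prod_sum _).trans ?_
  refine (Finset.prod_le_prod (g := fun _ => r) (fun _ _ => Finset.sum_nonneg fun _ _ =>
    abs_nonneg _) fun l _ => ?_).trans (by simp)
  by_cases hl : l = i
  · subst hl
    rw [Matrix.updateRow_self, sum_abs_single]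
    exact hr
  · rw [Matrix.updateRow_ne hl]
    exact hA l

/-- Row `i` has become the unit vector in direction `k`, so it clears column `k` from row `k`. What
remains of that row has ℓ¹ norm at most 5 / 4 - 3 / 4 = 1 / 2. -/
lemma abs_det_updateRow_single_le_half {A : Matrix (Fin n) (Fin n) ℝ} {r : ℝ} (hr : 1 ≤ r)
    (hr' : r ≤ 5 / 4) (hA : ∀ i, ∑ j, |A i j| ≤ r) (hd : ∀ i, 3 / 4 ≤ A i i) {i k : Fin n}
    (hik : k ≠ i) : |(A.updateRow i (Pi.single k 1)).det| ≤ r ^ n / 2 := by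
  set B := A.updateRow i (Pi.single k 1) with hB
  have hdet : B.det = (B.updateRow k (B k + (-A k k) • B i)).det :=
    (Matrix.det_updateRow_add_smul_self B hik _).symm
  rw [hdet]
  refine (abs_det_le_prod_sum _).trans ?_
  rw [← Finset.mul_prod_erase Finset.univ _ (Finset.mem_univ k)]
  have h1 : ∑ j, |(B.updateRow k (B k + (-A k k) • B i)) k j| ≤ 1 / 2 := by
    rw [Matrix.updateRow_self]
    have h2 : ∀ j, |(B k + (-A k k) • B i) j| = if j = k then 0 else |A k j| := by
      intro j
      rw [hB, Matrix.updateRow_ne hik, Matrix.updateRow_self]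
      split_ifs with h
      · subst h; simp
      · simp [h]
    simp only [h2]
    have h3 : ∑ j, |A k j| = |A k k| + ∑ j, if j = k then 0 else |A k j| := by
      rw [← Finset.sum_erase_add Finset.univ _ (Finset.mem_univ k), add_comm]
      congr 1
      rw [← Finset.sum_erase_add Finset.univ _ (Finset.mem_univ k)]
      simp only [if_true, add_zero]
      exact Finset.sum_congr rfl fun j hj => by rw [if_neg (Finset.ne_of_mem_erase hj)]
    have h4 := hA k
    have h5 := hd k
    have h6 := le_abs_self (A k k)
    linarith
  have h7 : ∏ l ∈ Finset.univ.erase k, ∑ j, |(B.updateRow k (B k + (-A k k) • B i)) l j|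
      ≤ r ^ n := by
    refine (Finset.prod_le_prod (g := fun _ => r) (fun _ _ => Finset.sum_nonneg fun _ _ =>
      abs_nonneg _) fun l hl => ?_).trans ?_
    · rw [Matrix.updateRow_ne (Finset.ne_of_mem_erase hl)]
      by_cases hli : l = i
      · subst hli
        rw [hB, Matrix.updateRow_self, sum_abs_single]
        exact hr
      · rw [hB, Matrix.updateRow_ne hli]
        exact hA l
    · rw [Finset.prod_const]
      refine pow_le_pow_right₀ hr ((Finset.card_le_univ _).trans (by simp))
  have h8 : 0 ≤ ∏ l ∈ Finset.univ.erase k, ∑ j, |(B.updateRow k (B k + (-A k k) • B i)) l j| :=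
    Finset.prod_nonneg fun _ _ => Finset.sum_nonneg fun _ _ => abs_nonneg _
  nlinarith

lemma det_updateRow_eq_sum (A : Matrix (Fin n) (Fin n) ℝ) (i : Fin n) (ζ : Fin n → ℝ) :
    (A.updateRow i ζ).det = ∑ k, ζ k * (A.updateRow i (Pi.single k 1)).det := by
  have h := fun b => Matrix.cramer_transpose_apply A b i
  rw [← h]
  conv_lhs => rw [pi_eq_sum_univ' ζ, map_sum]
  rw [Finset.sum_apply]
  refine Finset.sum_congr rfl fun k _ => ?_
  rw [map_smul, Pi.smul_apply, smul_eq_mul, ← h]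

/-- A matrix with determinant at least one and rows of `ℓ¹` norm close to one, whose diagonal is
not small, has diagonal close to one. -/
lemma two_le_of_one_le_det {A : Matrix (Fin n) (Fin n) ℝ} {r : ℝ} (hr : 1 ≤ r) (hr' : r ≤ 5 / 4)
    (hA : ∀ i, ∑ j, |A i j| ≤ r) (hd : ∀ i, 3 / 4 ≤ A i i) (hdet : 1 ≤ A.det) (i : Fin n) :
    2 ≤ (A i i + r) * r ^ n := by
  have h1 := det_updateRow_eq_sum A i (A i)
  rw [Matrix.updateRow_eq_self] at h1
  have hrn : 0 ≤ r ^ n := by positivity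
  -- Cofactor expansion along row `i`: the diagonal cofactor is at most `r ^ n` and the others at
  -- most half of that, so weight off the diagonal is wasted.
  have h2 : ∑ k, A i k * (A.updateRow i (Pi.single k 1)).det
      ≤ A i i * r ^ n + ∑ k ∈ Finset.univ.erase i, |A i k| * (r ^ n / 2) := by
    rw [← Finset.add_sum_erase Finset.univ _ (Finset.mem_univ i)]
    refine add_le_add ?_ (Finset.sum_le_sum fun k hk => ?_)
    · exact mul_le_mul_of_nonneg_left ((le_abs_self _).trans
        (abs_det_updateRow_single_le hr hA i i)) (by linarith [hd i])
    · refine (le_abs_self _).trans ?_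
      rw [abs_mul]
      exact mul_le_mul_of_nonneg_left
        (abs_det_updateRow_single_le_half hr hr' hA hd (Finset.ne_of_mem_erase hk)) (abs_nonneg _)
  rw [← Finset.sum_mul] at h2
  have h3 := Finset.add_sum_erase Finset.univ (fun k => |A i k|) (Finset.mem_univ i)
  have h4 := hA i
  have h5 := le_abs_self (A i i)
  have h6 : ∑ k ∈ Finset.univ.erase i, |A i k| ≤ r - A i i := by linarith
  nlinarith

/-- At `r = 1` the expression is `2 - τ`, so continuity leaves room to the right. This contradicts
`two_le_of_one_le_det` once a diagonal entry falls below `1 - τ`. -/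
lemma exists_radius {τ : ℝ} (hτ : 0 < τ) (n : ℕ) :
    ∃ r : ℝ, 1 < r ∧ r ≤ 1 + τ ∧ (1 - τ + r) * r ^ n < 2 := by
  have hcont : ContinuousAt (fun r : ℝ => (1 - τ + r) * r ^ n) 1 := by fun_prop
  have h1 : ∀ᶠ r in nhds (1 : ℝ), (1 - τ + r) * r ^ n < 2 :=
    hcont.eventually (gt_mem_nhds (by simp; linarith))
  obtain ⟨ε, hε, h⟩ := Metric.eventually_nhds_iff.1 h1
  have hpos : 0 < min τ (ε / 2) := by positivity
  refine ⟨1 + min τ (ε / 2), by linarith, by linarith [min_le_left τ (ε / 2)], h ?_⟩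
  rw [Real.dist_eq, add_sub_cancel_left, abs_of_pos (by positivity)]
  linarith [min_le_right τ (ε / 2)]

lemma isCompact_polarSet {K : Set (Fin n → ℝ)} {r : ℝ} (h : ∀ ξ ∈ polarSet K, ∑ i, |ξ i| ≤ r) :
    IsCompact (polarSet K) := by
  refine Metric.isCompact_of_isClosed_isBounded (isClosed_polarSet K)
    ((Metric.isBounded_iff_subset_closedBall 0).2 ⟨r, fun ζ hζ => ?_⟩)
  rw [mem_closedBall_zero_iff]
  exact (norm_le_sum_abs ζ).trans (h ζ hζ)

/-- Cramer's rule: `A.det • x` is the vector of cofactors of row `i`. -/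
lemma det_updateRow_eq_of_mulVec {A : Matrix (Fin n) (Fin n) ℝ} {i : Fin n} {x : Fin n → ℝ}
    (hx : A.mulVec x = Pi.single i 1) (ζ : Fin n → ℝ) :
    (A.updateRow i ζ).det = A.det * (x ⬝ᵥ ζ) := by
  have h1 := Matrix.mulVec_cramer A.transpose ζ
  rw [Matrix.det_transpose] at h1
  have h2 : x ⬝ᵥ (A.transpose.mulVec (A.transpose.cramer ζ)) = A.transpose.cramer ζ i := by
    rw [Matrix.mulVec_transpose, dotProduct_comm, ← Matrix.dotProduct_mulVec, hx]
    simp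
  rw [← Matrix.cramer_transpose_apply, ← h2, h1, dotProduct_smul, smul_eq_mul]

/-- Bodies close to the cube can be moved by a linear map to touch all facets of the cube at their
centres while staying close to it. -/
theorem exists_linearEquiv_isNearCube (n : ℕ) [NeZero n] {δ : ℝ} (hδ : 0 < δ) : ∃ r : ℝ, 1 < r ∧
    ∀ K : Set (Fin n → ℝ), Convex ℝ K → IsClosed K → (∀ x ∈ K, -x ∈ K) → 0 ∈ K →
      (∀ x ∈ K, ‖x‖ ≤ 1) → (∀ ξ ∈ polarSet K, ∑ i, |ξ i| ≤ r) →
      ∃ S : (Fin n → ℝ) ≃ₗ[ℝ] (Fin n → ℝ), IsNearCube (S '' K) δ := by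
  -- The second term gives (1 - 3τ)(1 + δ) ≥ 1 + τ ≥ r, used for the polar bound; 1 / 8 keeps `r ≤ 5
  -- / 4` and `1 - τ` well above 3 / 4.
  set τ : ℝ := min (1 / 8) (δ / (4 + 3 * δ)) with hτdef
  have hτ : 0 < τ := by positivity
  have hτ8 : τ ≤ 1 / 8 := min_le_left _ _
  have hτδ : τ * (4 + 3 * δ) ≤ δ := by
    rw [← le_div_iff₀ (by positivity)]; exact min_le_right _ _
  obtain ⟨r, hr1, hrτ, hr2⟩ := exists_radius hτ n
  refine ⟨r, hr1, fun K hconv hclosed hneg h0 hnorm hpol => ?_⟩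
  -- Rows range over the polar. The diagonal constraint keeps the maximizer near the identity and
  -- turns out to be inactive.
  let C : Fin n → Set (Fin n → ℝ) := fun i => polarSet K ∩ {ζ | 3 / 4 ≤ ζ i}
  have hC : IsCompact (Set.univ.pi C) := isCompact_univ_pi fun i =>
    (isCompact_polarSet hpol).inter_right (isClosed_le continuous_const (continuous_apply i))
  have h1C : (1 : Matrix (Fin n) (Fin n) ℝ) ∈ Set.univ.pi C := by
    intro i _
    have h1 : (1 : Matrix (Fin n) (Fin n) ℝ) i = Pi.single i 1 := by
      ext j; simp [Matrix.one_apply, Pi.single_apply, eq_comm]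
    rw [h1]
    refine ⟨mem_polarSet_of_sum_abs_le hnorm (sum_abs_single i).le, ?_⟩
    simp only [Set.mem_ofPred_eq, Pi.single_eq_same]
    norm_num
  obtain ⟨A, hA, hmax⟩ := hC.exists_isMaxOn ⟨_, h1C⟩
    (f := fun A : Fin n → Fin n → ℝ => (Matrix.of A).det)
    (Continuous.continuousOn (Continuous.matrix_det continuous_id))
  have hrow : ∀ i, ∑ j, |A i j| ≤ r := fun i => hpol _ (hA i trivial).1
  have hdiag : ∀ i, 3 / 4 ≤ A i i := fun i => (hA i trivial).2
  have hdet : 1 ≤ (Matrix.of A).det := by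
    have h1 : (1 : Matrix (Fin n) (Fin n) ℝ).det ≤ (Matrix.of A).det := hmax h1C
    rwa [Matrix.det_one] at h1
  have hdiag' : ∀ i, 1 - τ ≤ A i i := by
    intro i
    by_contra! hlt
    have h1 := two_le_of_one_le_det (A := Matrix.of A) hr1.le (by linarith) hrow hdiag hdet i
    have h2 : (A i i + r) * r ^ n ≤ (1 - τ + r) * r ^ n := by gcongr
    simp only [Matrix.of_apply] at h1
    linarith
  have hdet0 : (Matrix.of A).det ≠ 0 := by linarith
  let S : (Fin n → ℝ) ≃ₗ[ℝ] (Fin n → ℝ) := (Matrix.toLin' (Matrix.of A)).equivOfDetNeZero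
    (by rwa [LinearMap.det_toLin'])
  have hS : ∀ x, S x = (Matrix.of A).mulVec x := fun x => by simp [S]
  have hSi : ∀ x i, S x i = x ⬝ᵥ A i := fun x i => by
    rw [hS, Matrix.mulVec, dotProduct_comm]; rfl
  refine ⟨S, hconv.linear_image S.toLinearMap, ?_, ?_, ?_, ?_, ?_⟩
  · exact S.toContinuousLinearEquiv.toHomeomorph.isClosedMap _ hclosed
  · rintro _ ⟨x, hx, rfl⟩
    exact ⟨-x, hneg x hx, map_neg S x⟩
  · rintro _ ⟨x, hx, rfl⟩
    refine (pi_norm_le_iff_of_nonneg zero_le_one).2 fun i => ?_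
    rw [hSi, Real.norm_eq_abs, abs_le]
    have h1 := (hA i trivial).1 x hx
    have h2 := (hA i trivial).1 (-x) (hneg x hx)
    rw [neg_dotProduct] at h2
    exact ⟨by linarith, h1⟩
  · intro i
    refine ⟨S.symm (Pi.single i 1), ?_, S.apply_symm_apply _⟩
    set x := S.symm (Pi.single i 1) with hx
    by_contra hxK
    -- If the preimage of a facet centre were outside `K`, moving row `i` one percent towards a
    -- separating ζ would raise the determinant; the diagonal entry, at least 7 / 8, stays above 3 /
    -- 4.
    obtain ⟨ζ, hζ, hlt⟩ := exists_mem_polarSet_of_notMem hclosed hconv h0 hxK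
    have hAx : (Matrix.of A).mulVec x = Pi.single i 1 := by
      rw [← hS, hx, S.apply_symm_apply]
    set ζ' : Fin n → ℝ := (99 / 100 : ℝ) • A i + (1 / 100 : ℝ) • ζ with hζ'
    have hζi : |ζ i| ≤ r := (Finset.single_le_sum (f := fun i => |ζ i|) (fun _ _ => abs_nonneg _)
      (Finset.mem_univ i)).trans (hpol ζ hζ)
    have hmem : (Matrix.of A).updateRow i ζ' ∈ Set.univ.pi C := by
      intro l _
      by_cases hl : l = i
      · subst hl
        rw [Matrix.updateRow_self]
        refine ⟨convex_polarSet K (hA l trivial).1 hζ (by norm_num) (by norm_num) (by norm_num), ?_⟩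
        simp only [Set.mem_ofPred_eq, hζ', Pi.add_apply, Pi.smul_apply, smul_eq_mul]
        have := hdiag' l
        have := (abs_le.1 hζi).1
        linarith
      · rw [Matrix.updateRow_ne hl]
        exact hA l trivial
    have h1 : ((Matrix.of A).updateRow i ζ').det ≤ (Matrix.of A).det := hmax hmem
    rw [det_updateRow_eq_of_mulVec hAx, hζ', dotProduct_add, dotProduct_smul, dotProduct_smul,
      ← hSi, hx, S.apply_symm_apply, ← hx, Pi.single_eq_same, smul_eq_mul, smul_eq_mul] at h1
    nlinarith
  · intro η hη
    have hmem : (fun j => ∑ i, η i * A i j) ∈ polarSet K := by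
      intro x hx
      have h1 := hη _ ⟨x, hx, rfl⟩
      refine le_trans (le_of_eq ?_) h1
      simp only [dotProduct, hSi, Finset.mul_sum, Finset.sum_mul]
      rw [Finset.sum_comm]
      exact Finset.sum_congr rfl fun i _ => Finset.sum_congr rfl fun j _ => by ring
    have h1 := hpol _ hmem
    -- Diagonal dominance: summed over columns and regrouped by rows, each |η_i| gets the factor 2
    -- A_ii minus the ℓ¹ norm of row `i`, at least 2 (1 - τ) - (1 + τ) = 1 - 3τ.
    have h2 : ∀ j, 2 * (|η j| * A j j) - ∑ i, |η i| * |A i j| ≤ |∑ i, η i * A i j| := by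
      intro j
      have h3 := Finset.add_sum_erase Finset.univ (fun i => η i * A i j) (Finset.mem_univ j)
      have h4 := Finset.add_sum_erase Finset.univ (fun i => |η i| * |A i j|) (Finset.mem_univ j)
      have h5 : |∑ i ∈ Finset.univ.erase j, η i * A i j|
          ≤ ∑ i ∈ Finset.univ.erase j, |η i| * |A i j| := by
        refine (Finset.abs_sum_le_sum_abs _ _).trans (le_of_eq ?_)
        exact Finset.sum_congr rfl fun i _ => abs_mul _ _
      have h6 : |A j j| = A j j := abs_of_pos (by linarith [hdiag j])
      have h7 := abs_sub_abs_le_abs_sub (η j * A j j) (-∑ i ∈ Finset.univ.erase j, η i * A i j)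
      rw [sub_neg_eq_add, h3, abs_mul, h6, abs_neg] at h7
      rw [← h4, h6]
      linarith
    have h8 := (Finset.sum_le_sum fun j (_ : j ∈ Finset.univ) => h2 j).trans h1
    rw [Finset.sum_sub_distrib, Finset.sum_comm] at h8
    have h9 : ∑ i, (1 - 3 * τ) * |η i| ≤ ∑ j, 2 * (|η j| * A j j) - ∑ i, ∑ j, |η i| * |A i j| := by
      rw [← Finset.sum_sub_distrib]
      refine Finset.sum_le_sum fun i _ => ?_
      rw [← Finset.mul_sum]
      have h10 := hrow i
      have h11 := hdiag' i
      have h12 : |η i| * (1 - 3 * τ) ≤ |η i| * (2 * A i i - ∑ j, |A i j|) :=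
        mul_le_mul_of_nonneg_left (by linarith) (abs_nonneg _)
      linarith
    rw [← Finset.mul_sum] at h9
    have h13 : (1 - 3 * τ) * ∑ i, |η i| ≤ (1 - 3 * τ) * (1 + δ) := by nlinarith
    exact le_of_mul_le_mul_left h13 (by linarith)

/-! ### Linear invariance and the dichotomy -/

lemma volume_image_mul_volume_polarSet (S : (Fin n → ℝ) ≃ₗ[ℝ] (Fin n → ℝ)) (K : Set (Fin n → ℝ)) :
    volume (S '' K) * volume (polarSet (S '' K)) = volume K * volume (polarSet K) := by
  set A := LinearMap.toMatrix' (S : (Fin n → ℝ) →ₗ[ℝ] (Fin n → ℝ)) with hA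
  have hS : ∀ x, S x = A.mulVec x := fun x => by
    rw [hA, ← Matrix.toLin'_apply, Matrix.toLin'_toMatrix']; rfl
  have hdetA : A.det = LinearMap.det (S : (Fin n → ℝ) →ₗ[ℝ] (Fin n → ℝ)) :=
    LinearMap.det_toMatrix' _
  have hdet : A.det ≠ 0 := by
    rw [hdetA]; exact (LinearEquiv.isUnit_det' S).ne_zero
  have hpol : polarSet (S '' K) = Matrix.toLin' A.transpose ⁻¹' polarSet K := by
    ext ξ
    simp only [polarSet, Set.forall_mem_image, Set.mem_preimage, Set.mem_ofPred_eq,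
      Matrix.toLin'_apply, hS]
    refine forall₂_congr fun x _ => ?_
    rw [Matrix.mulVec_transpose, dotProduct_comm x, ← Matrix.dotProduct_mulVec, dotProduct_comm]
  have himg : volume (S '' K) = ENNReal.ofReal |A.det| * volume K := by
    rw [hdetA]; exact Measure.addHaar_image_linearMap volume S.toLinearMap K
  rw [hpol, Measure.addHaar_preimage_linearMap _ (by rwa [LinearMap.det_toLin', Matrix.det_transpose]),
    LinearMap.det_toLin', Matrix.det_transpose, himg]
  have h1 : ENNReal.ofReal |A.det| * ENNReal.ofReal |A.det⁻¹| = 1 := by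
    rw [← ENNReal.ofReal_mul (abs_nonneg _), ← abs_mul, mul_inv_cancel₀ hdet]; simp
  calc _ = (ENNReal.ofReal |A.det| * ENNReal.ofReal |A.det⁻¹|) * (volume K * volume (polarSet K)) := by
        ring
    _ = _ := by rw [h1, one_mul]

lemma exists_sign_sum_abs (ξ : Fin n → ℝ) : ∃ s ∈ cubeSet n, s ⬝ᵥ ξ = ∑ i, |ξ i| := by
  choose e he using fun i => exists_unit_mul_eq_abs (ξ i)
  refine ⟨fun i => ((e i : ℤ) : ℝ), ?_, Finset.sum_congr rfl fun i _ => he i⟩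
  refine (pi_norm_le_iff_of_nonneg zero_le_one).2 fun i => ?_
  rw [Real.norm_eq_abs, abs_unit]

lemma polarSet_cubeSet : polarSet (cubeSet n) = crossSet n := by
  ext ξ
  refine ⟨fun h => ?_, fun h => mem_polarSet_of_sum_abs_le (fun x hx => hx) h⟩
  obtain ⟨s, hs, hsum⟩ := exists_sign_sum_abs ξ
  exact hsum.symm.trans_le (h s hs)

lemma IsNearCube.mono {K : Set (Fin n → ℝ)} {δ δ' : ℝ} (hK : IsNearCube K δ)
    (h : ∀ ξ ∈ polarSet K, ∑ i, |ξ i| ≤ 1 + δ') : IsNearCube K δ' :=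
  ⟨hK.convex, hK.isClosed, hK.neg_mem, hK.norm_le, hK.single_mem, h⟩

lemma IsNearCube.eq_cubeSet [NeZero n] {K : Set (Fin n → ℝ)} (hK : IsNearCube K 0) :
    K = cubeSet n := by
  refine Set.Subset.antisymm hK.norm_le fun z hz => ?_
  by_contra hzK
  obtain ⟨ζ, hζ, hlt⟩ := exists_mem_polarSet_of_notMem hK.isClosed hK.convex hK.zero_mem hzK
  have h1 := dotProduct_le_norm_mul_sum z ζ
  have h2 := hK.polar_le ζ hζ
  have h3 : ‖z‖ ≤ 1 := hz
  have h4 : 0 ≤ ∑ i, |ζ i| := Finset.sum_nonneg fun _ _ => abs_nonneg _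
  nlinarith

/-- The strict inequality balances a gain against an error measured by the same δ, so δ must be the
excess actually attained; compactness of the polar provides it. -/
lemma IsNearCube.exists_tight [NeZero n] {K : Set (Fin n → ℝ)} {δ : ℝ} (hK : IsNearCube K δ) :
    ∃ δ', 0 ≤ δ' ∧ δ' ≤ δ ∧ IsNearCube K δ' ∧ ∃ ξ₀ ∈ polarSet K, ∑ i, |ξ₀ i| = 1 + δ' := by
  have hs : (Pi.single 0 1 : Fin n → ℝ) ∈ polarSet K :=
    mem_polarSet_of_sum_abs_le hK.norm_le (sum_abs_single 0).le
  obtain ⟨ξ₀, hξ₀, hmax⟩ := (isCompact_polarSet hK.polar_le).exists_isMaxOn ⟨_, hs⟩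
    (f := fun ξ => ∑ i, |ξ i|) (by fun_prop)
  have h1 := hK.polar_le ξ₀ hξ₀
  have h2 : ∑ i, |(Pi.single 0 1 : Fin n → ℝ) i| ≤ ∑ i, |ξ₀ i| := hmax hs
  rw [sum_abs_single] at h2
  refine ⟨∑ i, |ξ₀ i| - 1, by linarith, by linarith, hK.mono fun ξ hξ => ?_, ξ₀, hξ₀, by ring⟩
  have h3 : ∑ i, |ξ i| ≤ ∑ i, |ξ₀ i| := hmax hξ
  linarith

/-- Local minimality of the volume product at the cube, with equality only for parallelepipeds. -/
theorem exists_volume_lt_or_eq_cubeSet (n : ℕ) [NeZero n] : ∃ r : ℝ, 1 < r ∧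
    ∀ K : Set (Fin n → ℝ), Convex ℝ K → IsClosed K → (∀ x ∈ K, -x ∈ K) → 0 ∈ K →
      (∀ x ∈ K, ‖x‖ ≤ 1) → (∀ ξ ∈ polarSet K, ∑ i, |ξ i| ≤ r) →
      volume (cubeSet n) * volume (crossSet n) < volume K * volume (polarSet K) ∨
      ∃ S : (Fin n → ℝ) ≃ₗ[ℝ] (Fin n → ℝ), S '' K = cubeSet n := by
  obtain ⟨δ₀, hδ₀, hmain⟩ := exists_volume_lt_of_isNearCube n
  obtain ⟨r, hr, hpos⟩ := exists_linearEquiv_isNearCube n hδ₀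
  refine ⟨r, hr, fun K hconv hclosed hneg h0 hnorm hpol => ?_⟩
  obtain ⟨S, hS⟩ := hpos K hconv hclosed hneg h0 hnorm hpol
  obtain ⟨δ, hδ, hδle, hSδ, hξ₀⟩ := hS.exists_tight
  rcases hδ.eq_or_lt with h | h
  · subst h
    exact Or.inr ⟨S, hSδ.eq_cubeSet⟩
  · left
    rw [← volume_image_mul_volume_polarSet S K]
    exact hmain δ _ h hδle hSδ hξ₀

/-! ### Passage to Euclidean space and the Banach-Mazur distance -/

section Transfer

open Mahler

/-- The identification of Euclidean space with the function space. -/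
abbrev euclid (n : ℕ) : EuclideanSpace ℝ (Fin n) ≃ₗ[ℝ] (Fin n → ℝ) := WithLp.linearEquiv 2 ℝ _

lemma volume_euclid_image (K : Set (EuclideanSpace ℝ (Fin n))) :
    volume (euclid n '' K) = volume K := by
  have h := EuclideanSpace.volume_preserving_symm_measurableEquiv_toLp (Fin n)
  have h2 := (h.symm _).measure_preimage_equiv K
  rw [← h2]
  congr 1
  ext y
  constructor
  · rintro ⟨x, hx, rfl⟩
    exact hx
  · intro hy
    exact ⟨_, hy, rfl⟩

lemma inner_eq_dotProduct (x y : EuclideanSpace ℝ (Fin n)) :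
    inner ℝ x y = euclid n x ⬝ᵥ euclid n y := by
  rw [PiLp.inner_apply]
  refine Finset.sum_congr rfl fun i _ => ?_
  simp [mul_comm]

lemma euclid_image_polar (K : Set (EuclideanSpace ℝ (Fin n))) :
    euclid n '' polar K = polarSet (euclid n '' K) := by
  ext ξ
  obtain ⟨ξ, rfl⟩ := (euclid n).surjective ξ
  simp only [(euclid n).injective.mem_set_image, polar, polarSet, Set.mem_ofPred_eq,
    Set.forall_mem_image, inner_eq_dotProduct]

lemma volumeProduct_eq (K : Set (EuclideanSpace ℝ (Fin n))) :
    volumeProduct K = volume (euclid n '' K) * volume (polarSet (euclid n '' K)) := by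
  rw [volumeProduct, ← euclid_image_polar, volume_euclid_image, volume_euclid_image]

lemma euclid_image_cube : euclid n '' cube n = cubeSet n := by
  ext ξ
  obtain ⟨ξ, rfl⟩ := (euclid n).surjective ξ
  simp only [(euclid n).injective.mem_set_image, cube, cubeSet, Set.mem_ofPred_eq]
  rw [pi_norm_le_iff_of_nonneg zero_le_one]
  rfl

lemma euclid_image_crossPolytope : euclid n '' crossPolytope n = crossSet n := by
  ext ξ
  obtain ⟨ξ, rfl⟩ := (euclid n).surjective ξ
  simp only [(euclid n).injective.mem_set_image, crossPolytope, crossSet, Set.mem_ofPred_eq]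
  rfl

lemma volumeProduct_cube :
    volumeProduct (cube n) = volume (cube n) * volume (crossPolytope n) := by
  rw [volumeProduct_eq, euclid_image_cube, polarSet_cubeSet, ← euclid_image_cube,
    ← euclid_image_crossPolytope, volume_euclid_image, volume_euclid_image]

lemma exists_pos_smul_subset {E : Type*} [NormedAddCommGroup E] [NormedSpace ℝ E] {A B : Set E}
    (hA : Bornology.IsBounded A) (hB : B ∈ nhds (0 : E)) : ∃ a : ℝ, 0 < a ∧ a • A ⊆ B := by
  obtain ⟨ε, hε, hball⟩ := Metric.mem_nhds_iff.1 hB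
  obtain ⟨R, hR, hAR⟩ := hA.exists_pos_norm_le
  refine ⟨ε / (2 * R), by positivity, ?_⟩
  rintro _ ⟨x, hx, rfl⟩
  apply hball
  rw [mem_ball_zero_iff, norm_smul, Real.norm_eq_abs, abs_of_pos (by positivity)]
  calc ε / (2 * R) * ‖x‖ ≤ ε / (2 * R) * R := by gcongr; exact hAR x hx
    _ = ε / 2 := by field_simp
    _ < ε := by linarith

lemma cube_eq : cube n = (euclid n).toContinuousLinearEquiv ⁻¹' Metric.closedBall 0 1 := by
  ext x
  rw [Set.mem_preimage, mem_closedBall_zero_iff, pi_norm_le_iff_of_nonneg zero_le_one]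
  rfl

lemma cube_mem_nhds : cube n ∈ nhds 0 := by
  rw [cube_eq]
  refine (euclid n).toContinuousLinearEquiv.continuous.continuousAt.preimage_mem_nhds ?_
  rw [map_zero]
  exact Metric.closedBall_mem_nhds 0 one_pos

lemma isBounded_cube : Bornology.IsBounded (cube n) := by
  have h1 : cube n = (euclid n).toContinuousLinearEquiv.symm '' Metric.closedBall 0 1 := by
    rw [ContinuousLinearEquiv.image_symm_eq_preimage, cube_eq]
  rw [h1]
  exact ((isCompact_closedBall (0 : Fin n → ℝ) 1).image
    (euclid n).toContinuousLinearEquiv.symm.continuous).isBounded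

lemma mem_nhds_zero_of_symmetric {E : Type*} [NormedAddCommGroup E] [NormedSpace ℝ E] {K : Set E}
    (hK : Convex ℝ K) (hsymm : -K = K) (hne : (interior K).Nonempty) : K ∈ nhds 0 := by
  obtain ⟨x, hx⟩ := hne
  have hx' : -x ∈ interior K := by
    have h1 : -x ∈ -interior K := Set.neg_mem_neg.2 hx
    have h2 : -interior K = interior (-K) := (Homeomorph.neg E).preimage_interior K
    rwa [h2, hsymm] at h1
  have := hK.interior hx hx' (a := 1 / 2) (b := 1 / 2) (by norm_num) (by norm_num) (by norm_num)
  rw [smul_neg, add_neg_cancel] at this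
  exact mem_interior_iff_mem_nhds.1 this

/-- The infimum of an empty set of reals is 0 by convention, so without this a bound on the distance
would supply no linear map. -/
lemma banachMazurDist_set_nonempty {K L : Set (EuclideanSpace ℝ (Fin n))}
    (hK : Bornology.IsBounded K) (hK0 : K ∈ nhds 0) (hL : Bornology.IsBounded L)
    (hL0 : L ∈ nhds 0) : {r : ℝ | ∃ a b : ℝ, 0 < a ∧ 0 < b ∧
      (∃ T : EuclideanSpace ℝ (Fin n) ≃ₗ[ℝ] EuclideanSpace ℝ (Fin n),
        a • K ⊆ T '' L ∧ T '' L ⊆ b • K) ∧ r = b / a}.Nonempty := by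
  obtain ⟨a, ha, haK⟩ := exists_pos_smul_subset hK hL0
  obtain ⟨c, hc, hcL⟩ := exists_pos_smul_subset hL hK0
  refine ⟨c⁻¹ / a, a, c⁻¹, ha, inv_pos.2 hc, ⟨LinearEquiv.refl ℝ _, ?_, ?_⟩, rfl⟩
  · rw [show LinearEquiv.refl ℝ _ '' L = L from Set.image_id L]
    exact haK
  · rw [Set.subset_smul_set_iff₀ (inv_ne_zero hc.ne'), inv_inv,
      show LinearEquiv.refl ℝ _ '' L = L from Set.image_id L]
    exact hcL

/-- An inclusion of `a • K` in `b • K` forces `a ≤ b` by comparing volumes, which are positive and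
finite; this needs `n ≠ 0`. The value 1 is attained by `T`. -/
lemma banachMazurDist_image_self [NeZero n] {K : Set (EuclideanSpace ℝ (Fin n))}
    (hK : Bornology.IsBounded K) (hK0 : K ∈ nhds 0) {L : Set (EuclideanSpace ℝ (Fin n))}
    {T : EuclideanSpace ℝ (Fin n) ≃ₗ[ℝ] EuclideanSpace ℝ (Fin n)} (hT : K = T '' L) :
    banachMazurDist K L = 1 := by
  have hlb : ∀ r ∈ {r : ℝ | ∃ a b : ℝ, 0 < a ∧ 0 < b ∧
      (∃ T : EuclideanSpace ℝ (Fin n) ≃ₗ[ℝ] EuclideanSpace ℝ (Fin n),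
        a • K ⊆ T '' L ∧ T '' L ⊆ b • K) ∧ r = b / a}, 1 ≤ r := by
    rintro r ⟨a, b, ha, hb, ⟨T', h1, h2⟩, rfl⟩
    rw [one_le_div ha]
    have h3 := measure_mono (μ := volume) (h1.trans h2)
    rw [Measure.addHaar_smul, Measure.addHaar_smul, abs_of_pos (by positivity),
      abs_of_pos (by positivity), finrank_euclideanSpace_fin] at h3
    have h4 : volume K ≠ 0 := (Measure.measure_pos_of_mem_nhds volume hK0).ne'
    have h5 := (ENNReal.mul_le_mul_iff_left h4 hK.measure_lt_top.ne).1 h3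
    rw [ENNReal.ofReal_le_ofReal_iff (by positivity)] at h5
    exact le_of_pow_le_pow_left₀ (NeZero.ne n) hb.le h5
  have hmem : (1 : ℝ) ∈ {r : ℝ | ∃ a b : ℝ, 0 < a ∧ 0 < b ∧
      (∃ T : EuclideanSpace ℝ (Fin n) ≃ₗ[ℝ] EuclideanSpace ℝ (Fin n),
        a • K ⊆ T '' L ∧ T '' L ⊆ b • K) ∧ r = b / a} :=
    ⟨1, 1, one_pos, one_pos, ⟨T, by rw [one_smul, hT], by rw [one_smul, hT]⟩, by simp⟩
  exact le_antisymm (csInf_le ⟨1, hlb⟩ hmem) (le_csInf ⟨1, hmem⟩ hlb)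

end Transfer

end MahlerCube

end

/-! ### The main theorem -/

theorem mainTheorem1 (n : ℕ) (hn : 1 ≤ n) :
    Mahler.volumeProduct (Mahler.cube n) =
        volume (Mahler.cube n) * volume (Mahler.crossPolytope n) ∧
    ∃ δ : ℝ, 0 < δ ∧
      ∀ K : ConvexBody (EuclideanSpace ℝ (Fin n)),
        (interior (K : Set (EuclideanSpace ℝ (Fin n)))).Nonempty →
        -(K : Set (EuclideanSpace ℝ (Fin n))) = K →
        Mahler.banachMazurDist (K : Set (EuclideanSpace ℝ (Fin n))) (Mahler.cube n) ≤ 1 + δ →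
        Mahler.volumeProduct (Mahler.cube n) ≤
            Mahler.volumeProduct (K : Set (EuclideanSpace ℝ (Fin n))) ∧
        (Mahler.volumeProduct (K : Set (EuclideanSpace ℝ (Fin n))) =
            Mahler.volumeProduct (Mahler.cube n) →
          Mahler.banachMazurDist (K : Set (EuclideanSpace ℝ (Fin n))) (Mahler.cube n) = 1 ∧
          Mahler.IsCenteredParallelepiped (K : Set (EuclideanSpace ℝ (Fin n)))) := by
  open MahlerCube in
  have : NeZero n := ⟨by omega⟩
  refine ⟨volumeProduct_cube, ?_⟩
  obtain ⟨r, hr, hmain⟩ := exists_volume_lt_or_eq_cubeSet n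
  -- Half of `r - 1` makes the distance strictly less than `r`, so some admissible ratio `b / a` is
  -- below `r` even if the infimum is not attained.
  refine ⟨(r - 1) / 2, by linarith, fun K hint hsymm hdist => ?_⟩
  have hKc := K.isCompact
  have hK0 := mem_nhds_zero_of_symmetric K.convex hsymm hint
  obtain ⟨ρ, ⟨a, b, ha, hb, ⟨T, hT1, hT2⟩, rfl⟩, hρ⟩ := exists_lt_of_csInf_lt
    (banachMazurDist_set_nonempty hKc.isBounded hK0 isBounded_cube cube_mem_nhds)
    (show Mahler.banachMazurDist (K : Set (EuclideanSpace ℝ (Fin n))) (Mahler.cube n) < r by linarith)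
  -- `R` maps `K` to a body inscribed in the cube and close to it.
  let R : EuclideanSpace ℝ (Fin n) ≃ₗ[ℝ] (Fin n → ℝ) :=
    (T.symm.trans (LinearEquiv.smulOfNeZero ℝ _ a ha.ne')).trans (euclid n)
  have hR : ∀ x, R x = euclid n (a • T.symm x) := fun x => rfl
  have hRsub : ∀ x ∈ (K : Set (EuclideanSpace ℝ (Fin n))), R x ∈ cubeSet n := by
    intro x hx
    obtain ⟨y, hy, hyx⟩ := hT1 (Set.smul_mem_smul_set hx)
    rw [hR, ← map_smul, ← hyx, T.symm_apply_apply, ← euclid_image_cube]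
    exact Set.mem_image_of_mem _ hy
  have hRsup : ∀ z ∈ cubeSet n, (a / b) • z ∈ R '' K := by
    intro z hz
    rw [← euclid_image_cube] at hz
    obtain ⟨y, hy, rfl⟩ := hz
    obtain ⟨x, hx, hxy⟩ := hT2 (Set.mem_image_of_mem T hy)
    refine ⟨x, hx, ?_⟩
    have h1 : y = b • T.symm x := by
      rw [← map_smul]
      exact (T.symm_apply_apply y).symm.trans (congrArg T.symm hxy.symm)
    rw [hR, h1, map_smul, map_smul, smul_smul, div_mul_cancel₀ _ hb.ne']
  have hKR : euclid n '' K = ((R.symm.trans (euclid n)) : (Fin n → ℝ) ≃ₗ[ℝ] (Fin n → ℝ)) '' (R '' K) := by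
    rw [← Set.image_comp]
    refine Set.image_congr fun x _ => ?_
    simp
  have hvol : Mahler.volumeProduct (K : Set (EuclideanSpace ℝ (Fin n)))
      = volume (R '' K) * volume (polarSet (R '' K)) := by
    rw [volumeProduct_eq, hKR, volume_image_mul_volume_polarSet]
  have hcube : Mahler.volumeProduct (Mahler.cube n) = volume (cubeSet n) * volume (crossSet n) := by
    rw [volumeProduct_eq, euclid_image_cube, polarSet_cubeSet]
  have hdich := hmain (R '' K) (K.convex.linear_image R.toLinearMap)
    (hKc.image R.toContinuousLinearEquiv.continuous).isClosed
    (by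
      rintro _ ⟨x, hx, rfl⟩
      refine ⟨-x, ?_, map_neg R x⟩
      rw [← hsymm]
      exact Set.neg_mem_neg.2 hx)
    ⟨0, mem_of_mem_nhds hK0, map_zero R⟩
    (by
      rintro _ ⟨x, hx, rfl⟩
      exact hRsub x hx)
    (by
      intro ξ hξ
      -- The image contains the cube scaled by `a / b`; testing ξ on its vertex with matching signs
      -- bounds the ℓ¹ norm by `b / a < r`.
      obtain ⟨s, hs, hsum⟩ := exists_sign_sum_abs ξ
      have h1 := hξ _ (hRsup s hs)
      rw [smul_dotProduct, hsum, smul_eq_mul, div_mul_eq_mul_div, div_le_one hb] at h1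
      rw [div_lt_iff₀ ha] at hρ
      refine le_of_mul_le_mul_left ?_ ha
      linarith)
  rcases hdich with hlt | ⟨S, hS⟩
  · rw [hvol, hcube]
    exact ⟨hlt.le, fun h => absurd h hlt.ne'⟩
  · have heq : (K : Set (EuclideanSpace ℝ (Fin n)))
        = ((euclid n).trans (S.symm.trans R.symm)) '' Mahler.cube n := by
      have h1 : (R.trans S) '' (K : Set (EuclideanSpace ℝ (Fin n))) = cubeSet n := by
        rw [← hS, ← Set.image_comp]; rfl
      have h2 : ((euclid n).trans (S.symm.trans R.symm)) '' Mahler.cube n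
          = (R.trans S).symm '' (euclid n '' Mahler.cube n) := by
        rw [← Set.image_comp]; rfl
      rw [h2, euclid_image_cube, ← h1]
      exact ((R.trans S).toEquiv.symm_image_image _).symm
    refine ⟨?_, fun _ => ⟨banachMazurDist_image_self hKc.isBounded hK0 heq, _, heq⟩⟩
    rw [hvol, hcube, ← volume_image_mul_volume_polarSet S, hS, polarSet_cubeSet]
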